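/- Let $A$ be a (not necessarily unital) complex C$^*$-algebra with multiplier algebra $M(A)$. The strict topology on $M(A)$ is the one generated by the maps $x\mapsto xb$ and $x\mapsto bx$, $b\in A$, into $A$ with its norm. A strongly continuous one-parameter representation on $A$ is a map $\alpha:\mathbb R\to\mathcal B(A)$ with $\alpha_{s+t}=\alpha_s\alpha_t$, $\alpha_0=\iota$, $\|\alpha_t\|\le 1$ for all $s,t\in\mathbb R$, and $t\mapsto\alpha_t(a)$ norm continuous for all $a\in A$. It is called semi-multiplicative if there are strongly continuous one-parameter representations $\alpha^l,\alpha^r$ on $A$ with $\alpha^l_t(b)\,\alpha_t(a)=\alpha_t(ba)$ and $\alpha_t(a)\,\alpha^r_t(b)=\alpha_t(ab)$ for all $a,b\in A$, $t\in\mathbb R$. In that case each $\alpha_t$ has a unique linear extension $\overline{\alpha_t}:M(A)\to M(A)$ that is strictly continuous on bounded sets. For $z\in\mathbb C$ let $S(z)=\{y\in\mathbb C: \operatorname{Im} y \text{ lies between } 0 \text{ and } \operatorname{Im} z\}$ (endpoints included), with interior $S(z)^0$. The operator $\alpha_z$ in $A$ has as domain $D(\alpha_z)$ the set of all $a\in A$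 for which there is $f:S(z)\to A$ that is norm continuous on $S(z)$, analytic on $S(z)^0$ and satisfies $f(t)=\alpha_t(a)$ for all $t\in\mathbb R$; then $\alpha_z(a)=f(z)$. The operator $\overline{\alpha}_z$ in $M(A)$ has as domain the set of all $a\in M(A)$ for which there is $f:S(z)\to M(A)$ that is strictly continuous on $S(z)$, norm analytic on $S(z)^0$ and satisfies $f(t)=\overline{\alpha_t}(a)$ for all $t\in\mathbb R$; then $\overline{\alpha}_z(a)=f(z)$. Products of partially defined operators are taken on their natural domains, e.g. $D(\alpha_z\beta_z)=\{a\in D(\beta_z):\beta_z(a)\in D(\alpha_z)\}$. A strict core for an operator $T$ in $M(A)$ is a subspace $D\subseteq D(T)$ such that the graph of $T$ is the closure of the graph of $T|_D$ in the product of the strict topologies. Let $\alpha$ and $\beta$ be semi-multiplicative strongly continuous one-parameter representations on $A$ that commute, i.e. $\alpha_s\beta_t=\beta_t\alpha_s$ for all $s,t\in\mathbb R$, and put $\gamma_t=\alpha_t\beta_t$ for $t\in\mathbb R$ (this is again a semi-multiplicative strongly continuous one-parameter representation). Then for every $z\in\mathbb C$: $$\overline{\alpha}_z\,\overline{\beta}_z\subseteq\overline{\gamma}_z,\qquad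 \overline{\beta}_z\,\overline{\alpha}_z\subseteq\overline{\gamma}_z,$$ and $D(\alpha_z\beta_z)\cap D(\beta_z\alpha_z)$, viewed as a subspace of $M(A)$, is a strict core for $\overline{\gamma}_z$. -/

import Mathlib

open scoped MultiplierAlgebra

noncomputable section

namespace OneParam

/-! ### Partially defined operators -/

/-- The product `g f` of two partially defined operators, on its natural domain
`{x ∈ D(f) | f x ∈ D(g)}`. -/
def pcomp {E : Type*} [AddCommGroup E] [Module ℂ E] (g f : E →ₗ.[ℂ] E) : E →ₗ.[ℂ] E :=
  g.comp (f.domRestrict ((g.domain.comap f.toFun).map f.domain.subtype)) (by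
    rintro ⟨x, ⟨⟨y, hy⟩, hgy, rfl⟩, hx⟩
    exact hgy)

theorem mem_pcomp_graph {E : Type*} [AddCommGroup E] [Module ℂ E] {g f : E →ₗ.[ℂ] E} {x y : E} :
    (x, y) ∈ (pcomp g f).graph ↔ ∃ w, (x, w) ∈ f.graph ∧ (w, y) ∈ g.graph := by
  simp only [LinearPMap.mem_graph_iff]
  constructor
  · rintro ⟨⟨x', ⟨⟨y', hy'⟩, hgy, rfl⟩, hx⟩, rfl, rfl⟩
    exact ⟨f ⟨y', hy'⟩, ⟨⟨y', hy'⟩, rfl, rfl⟩, ⟨⟨f ⟨y', hy'⟩, hgy⟩, rfl, rfl⟩⟩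
  · rintro ⟨w, ⟨⟨x', hx'⟩, rfl, rfl⟩, ⟨⟨w', hw'⟩, h1, rfl⟩⟩
    have hw : w' = f ⟨x', hx'⟩ := h1
    subst hw
    exact ⟨⟨x', ⟨⟨x', hx'⟩, hw', rfl⟩, hx'⟩, rfl, rfl⟩

/-! ### One-parameter representations on a Banach space -/

/-- Strongly continuous one-parameter representations by contractions. -/
structure IsRep {E : Type*} [NormedAddCommGroup E] [NormedSpace ℂ E]
    (α : ℝ → E →L[ℂ] E) : Prop where
  add : ∀ s t : ℝ, α (s + t) = α s ∘L α t
  zero : α 0 = ContinuousLinearMap.id ℂ E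
  norm_le : ∀ t : ℝ, ‖α t‖ ≤ 1
  continuous : ∀ a : E, Continuous fun t : ℝ => α t a

/-- The closed horizontal strip between the real axis and the line through `z`. -/
def strip (z : ℂ) : Set ℂ := {y : ℂ | y.im ∈ Set.uIcc 0 z.im}

/-- The graph of the norm analytic continuation `α_z`: all `(a, f z)` where `f` is norm continuous
on the strip, analytic in its interior, and equal to `t ↦ α_t(a)` on the real axis. -/
def contGraph {E : Type*} [NormedAddCommGroup E] [NormedSpace ℂ E]
    (α : ℝ → E →L[ℂ] E) (z : ℂ) : Submodule ℂ (E × E) where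
  carrier := {p | ∃ f : ℂ → E, ContinuousOn f (strip z) ∧
    AnalyticOnNhd ℂ f (interior (strip z)) ∧ (∀ t : ℝ, f t = α t p.1) ∧ f z = p.2}
  add_mem' := by
    rintro p q ⟨f, hf, hf', hfα, hfz⟩ ⟨g, hg, hg', hgα, hgz⟩
    exact ⟨f + g, hf.add hg, hf'.add hg', fun t => by simp [hfα, hgα], by simp [hfz, hgz]⟩
  zero_mem' := ⟨fun _ => 0, continuousOn_const, analyticOnNhd_const, by simp, rfl⟩
  smul_mem' := by
    rintro c p ⟨f, hf, hf', hfα, hfz⟩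
    exact ⟨fun u => c • f u, hf.const_smul c, analyticOnNhd_const.smul hf',
      fun t => by simp [hfα], by simp [hfz]⟩

/-- The norm analytic continuation `α_z`, a partially defined operator in `E`
(see `cont_graph` for its graph). -/
def cont {E : Type*} [NormedAddCommGroup E] [NormedSpace ℂ E]
    (α : ℝ → E →L[ℂ] E) (z : ℂ) : E →ₗ.[ℂ] E :=
  (contGraph α z).toLinearPMap

/-! ### The strict topology on the multiplier algebra -/

/-- The strict topology on `M(A)`: the coarsest one for which all maps `x ↦ x b` and `x ↦ b x`
from `M(A)` to `A`, with `b ∈ A`, are norm continuous. For a double centralizer `x`, `x.fst b`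
is `x b` and `x.snd b` is `b x`. -/
@[reducible]
def strictTopology (A : Type*) [NonUnitalCStarAlgebra A] : TopologicalSpace 𝓜(ℂ, A) :=
  TopologicalSpace.induced
    (fun x => ((fun b => x.fst b, fun b => x.snd b) : (A → A) × (A → A))) inferInstance

/-- Strict continuity on a set of a function with values in `M(A)`. -/
def StrictContinuousOn {A : Type*} [NonUnitalCStarAlgebra A] {X : Type*} [TopologicalSpace X]
    (f : X → 𝓜(ℂ, A)) (s : Set X) : Prop :=
  @ContinuousOn X 𝓜(ℂ, A) _ (strictTopology A) f s

theorem strictContinuousOn_iff {A : Type*} [NonUnitalCStarAlgebra A] {X : Type*}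
    [TopologicalSpace X] {f : X → 𝓜(ℂ, A)} {s : Set X} :
    StrictContinuousOn f s ↔
      ∀ b : A, ContinuousOn (fun u => (f u).fst b) s ∧ ContinuousOn (fun u => (f u).snd b) s := by
  let _ := strictTopology A
  have hind : Topology.IsInducing (fun x : 𝓜(ℂ, A) =>
      ((fun b => x.fst b, fun b => x.snd b) : (A → A) × (A → A))) := ⟨rfl⟩
  refine Iff.trans (hind.continuousOn_iff (f := f) (s := s)) ?_
  constructor
  · intro h b
    exact ⟨(continuous_apply b).comp_continuousOn (continuous_fst.comp_continuousOn h),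
      (continuous_apply b).comp_continuousOn (continuous_snd.comp_continuousOn h)⟩
  · intro h
    exact (continuousOn_pi.2 fun b => (h b).1).prodMk (continuousOn_pi.2 fun b => (h b).2)

/-- The inclusion of `A` in `M(A)`. -/
def incl (A : Type*) [NonUnitalCStarAlgebra A] : A →ₗ[ℂ] 𝓜(ℂ, A) where
  toFun a := (a : 𝓜(ℂ, A))
  map_add' a b := map_add (DoubleCentralizer.coeHom (𝕜 := ℂ) (A := A)) a b
  map_smul' c a := map_smul (DoubleCentralizer.coeHom (𝕜 := ℂ) (A := A)) c a

/-- `θ` is a linear extension of `ρ` to `M(A)` that is strictly continuous on bounded sets. -/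
structure IsStrictExtension {A : Type*} [NonUnitalCStarAlgebra A] (ρ : A →L[ℂ] A)
    (θ : 𝓜(ℂ, A) →ₗ[ℂ] 𝓜(ℂ, A)) : Prop where
  extends_apply : ∀ a : A, θ (a : 𝓜(ℂ, A)) = (ρ a : 𝓜(ℂ, A))
  continuousOn : ∀ s : Set 𝓜(ℂ, A), Bornology.IsBounded s →
    @ContinuousOn 𝓜(ℂ, A) 𝓜(ℂ, A) (strictTopology A) (strictTopology A) θ s

/-- The strict extension of `ρ` to `M(A)`. It exists and is unique for the operators considered
below (see `existsUnique_strictExtension` and its corollaries). -/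
def strictExtension {A : Type*} [NonUnitalCStarAlgebra A] (ρ : A →L[ℂ] A) :
    𝓜(ℂ, A) →ₗ[ℂ] 𝓜(ℂ, A) :=
  Classical.epsilon (IsStrictExtension ρ)

/-! ### Semi-multiplicative representations and their strict continuations -/

/-- `α` is semi-multiplicative: there are strongly continuous one-parameter representations `αl`,
`αr` with `αl_t(b) α_t(a) = α_t(b a)` and `α_t(a) αr_t(b) = α_t(a b)`. -/
def IsSemiMultiplicative {A : Type*} [NonUnitalCStarAlgebra A] (α : ℝ → A →L[ℂ] A) : Prop :=
  ∃ αl αr : ℝ → A →L[ℂ] A, IsRep αl ∧ IsRep αr ∧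
    ∀ (t : ℝ) (a b : A), αl t b * α t a = α t (b * a) ∧ α t a * αr t b = α t (a * b)

/-- The graph of the strict analytic continuation of `α`: all `(a, f z)` where `f` is strictly
continuous on the strip, norm analytic in its interior, and equal to `t ↦ α_t(a)` on the real axis,
`α_t` being extended to `M(A)`. -/
def strictContGraph {A : Type*} [NonUnitalCStarAlgebra A] (α : ℝ → A →L[ℂ] A) (z : ℂ) :
    Submodule ℂ (𝓜(ℂ, A) × 𝓜(ℂ, A)) where
  carrier := {p | ∃ f : ℂ → 𝓜(ℂ, A), StrictContinuousOn f (strip z) ∧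
    AnalyticOnNhd ℂ f (interior (strip z)) ∧
    (∀ t : ℝ, f t = strictExtension (α t) p.1) ∧ f z = p.2}
  add_mem' := by
    rintro p q ⟨f, hf, hf', hfα, hfz⟩ ⟨g, hg, hg', hgα, hgz⟩
    rw [strictContinuousOn_iff] at hf hg
    refine ⟨f + g, strictContinuousOn_iff.2 fun b => ⟨?_, ?_⟩, hf'.add hg',
      fun t => by simp [hfα, hgα], by simp [hfz, hgz]⟩
    · exact (hf b).1.add (hg b).1
    · exact (hf b).2.add (hg b).2
  zero_mem' := ⟨fun _ => 0, strictContinuousOn_iff.2 fun b =>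
    ⟨continuousOn_const, continuousOn_const⟩, analyticOnNhd_const, by simp, rfl⟩
  smul_mem' := by
    rintro c p ⟨f, hf, hf', hfα, hfz⟩
    rw [strictContinuousOn_iff] at hf
    refine ⟨fun u => c • f u, strictContinuousOn_iff.2 fun b => ⟨?_, ?_⟩,
      analyticOnNhd_const.smul hf', fun t => by simp [hfα], by simp [hfz]⟩
    · exact (hf b).1.const_smul c
    · exact (hf b).2.const_smul c

/-- The strict analytic continuation of `α` at `z`, a partially defined operator in `M(A)`
(see `strictCont_graph` for its graph). -/
def strictCont {A : Type*} [NonUnitalCStarAlgebra A] (α : ℝ → A →L[ℂ] A) (z : ℂ) :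
    𝓜(ℂ, A) →ₗ.[ℂ] 𝓜(ℂ, A) :=
  (strictContGraph α z).toLinearPMap

/-- `S` is a strict core for `T`: it is contained in the domain, and the graph of `T` is the strict
closure of the graph of the restriction of `T` to `S`. -/
def IsStrictCore {A : Type*} [NonUnitalCStarAlgebra A] (T : 𝓜(ℂ, A) →ₗ.[ℂ] 𝓜(ℂ, A))
    (S : Submodule ℂ 𝓜(ℂ, A)) : Prop :=
  S ≤ T.domain ∧
    @closure (𝓜(ℂ, A) × 𝓜(ℂ, A))
      (@instTopologicalSpaceProd _ _ (strictTopology A) (strictTopology A))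
      ((T.domRestrict S).graph : Set (𝓜(ℂ, A) × 𝓜(ℂ, A))) = T.graph

/-! ### The continuations are well defined -/

theorem strip_eq_of_pos {z : ℂ} (hz : 0 < z.im) : strip z = Complex.im ⁻¹' Set.Icc 0 z.im := by
  ext y
  simp [strip, Set.uIcc_of_le hz.le]

theorem interior_strip_of_pos {z : ℂ} (hz : 0 < z.im) :
    interior (strip z) = Complex.im ⁻¹' Set.Ioo 0 z.im := by
  rw [strip_eq_of_pos hz, ← Complex.isOpenMap_im.preimage_interior_eq_interior_preimage
    Complex.continuous_im, interior_Icc]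

/-- A scalar function that vanishes on the real axis vanishes at the centre of every square in the
strip that has a side on that axis. -/
theorem eq_zero_of_square {g : ℂ → ℂ} {z c : ℂ} (hz : 0 < z.im)
    (hg : ContinuousOn g (strip z)) (hg' : AnalyticOnNhd ℂ g (interior (strip z)))
    (h0 : ∀ t : ℝ, g t = 0) (hc : 0 < c.im) (hc' : 2 * c.im < z.im) : g c = 0 := by
  rw [interior_strip_of_pos hz] at hg'
  rw [strip_eq_of_pos hz] at hg
  set r := c.im with hr
  set U : Set ℂ := Set.Ioo (-r) r ×ℂ Set.Ioo (-r) r with hU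
  have hne : (-r) ≠ r := by linarith
  have hcl : closure U = Set.Icc (-r) r ×ℂ Set.Icc (-r) r := by
    rw [hU, Complex.closure_reProdIm, closure_Ioo hne]
  have key : ∀ m : ℂ, (m = 1 ∨ m = -1 ∨ m = Complex.I ∨ m = -Complex.I) →
      DiffContOnCl ℂ (fun ζ => g (c + m * ζ)) U := by
    intro m hm
    constructor
    · refine hg'.differentiableOn.comp (by fun_prop) ?_
      rintro ζ ⟨⟨h1, h2⟩, h3, h4⟩
      rcases hm with rfl | rfl | rfl | rfl <;>
        simp [← hr] <;> constructor <;> linarith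
    · rw [hcl]
      refine hg.comp (by fun_prop) ?_
      rintro ζ ⟨⟨h1, h2⟩, h3, h4⟩
      rcases hm with rfl | rfl | rfl | rfl <;>
        simp [← hr] <;> constructor <;> linarith
  have hzero : ∀ w : ℂ, w.im = 0 → g w = 0 := by
    intro w hw
    have : w = ((w.re : ℝ) : ℂ) := Complex.ext (by simp) (by simp [hw])
    rw [this, h0]
  have hG : DiffContOnCl ℂ (fun ζ => (g (c + 1 * ζ) * g (c + (-1) * ζ)) *
      (g (c + Complex.I * ζ) * g (c + (-Complex.I) * ζ))) U := by
    have h1 := key 1 (by simp)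
    have h2 := key (-1) (by simp)
    have h3 := key Complex.I (by simp)
    have h4 := key (-Complex.I) (by simp)
    exact ⟨(h1.1.mul h2.1).mul (h3.1.mul h4.1), (h1.2.mul h2.2).mul (h3.2.mul h4.2)⟩
  have hb : Bornology.IsBounded U :=
    (Metric.isBounded_Ioo _ _).reProdIm (Metric.isBounded_Ioo _ _)
  have hmax := Complex.norm_le_of_forall_mem_frontier_norm_le hb hG (C := 0) (z := 0)
    (by
      intro ζ hζ
      have hζ' : ζ ∈ closure U := frontier_subset_closure hζ
      rw [hcl] at hζ'
      obtain ⟨⟨h1, h2⟩, h3, h4⟩ := hζ'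
      have hnot : ζ ∉ U := by
        have hop : IsOpen U := isOpen_Ioo.reProdIm isOpen_Ioo
        rw [hop.frontier_eq] at hζ
        exact hζ.2
      have : ζ.re = -r ∨ ζ.re = r ∨ ζ.im = -r ∨ ζ.im = r := by
        by_contra hcon
        push Not at hcon
        obtain ⟨k1, k2, k3, k4⟩ := hcon
        exact hnot ⟨⟨lt_of_le_of_ne h1 k1.symm, lt_of_le_of_ne h2 k2⟩,
          ⟨lt_of_le_of_ne h3 k3.symm, lt_of_le_of_ne h4 k4⟩⟩
      rcases this with h | h | h | h
      · rw [hzero (c + Complex.I * ζ) (by simp [h, ← hr])]; simp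
      · rw [hzero (c + (-Complex.I) * ζ) (by simp [h, ← hr])]; simp
      · rw [hzero (c + 1 * ζ) (by simp [h, ← hr])]; simp
      · rw [hzero (c + (-1) * ζ) (by simp [h, ← hr])]; simp)
    (by rw [hcl]; constructor <;> constructor <;> simp <;> linarith)
  have h4 := norm_le_zero_iff.1 hmax
  simpa using h4

theorem scalar_unique_of_pos {g : ℂ → ℂ} {z : ℂ} (hz : 0 < z.im)
    (hg : ContinuousOn g (strip z)) (hg' : AnalyticOnNhd ℂ g (interior (strip z)))
    (h0 : ∀ t : ℝ, g t = 0) : g z = 0 := by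
  have hsq : ∀ c : ℂ, 0 < c.im → 2 * c.im < z.im → g c = 0 := fun c =>
    eq_zero_of_square hz hg hg' h0
  have hint := interior_strip_of_pos hz
  have hconn : IsPreconnected (interior (strip z)) := by
    rw [hint]
    exact ((convex_Ioo (0 : ℝ) z.im).linear_preimage Complex.imLm).isPreconnected
  set c : ℂ := ⟨0, z.im / 4⟩ with hc
  have hcm : c ∈ interior (strip z) := by
    rw [hint]; constructor <;> simp [hc] <;> linarith
  have hev : g =ᶠ[nhds c] 0 := by
    have hop : IsOpen (Complex.im ⁻¹' Set.Ioo 0 (z.im / 2)) :=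
      isOpen_Ioo.preimage Complex.continuous_im
    filter_upwards [hop.mem_nhds (show c ∈ _ by constructor <;> simp [hc] <;> linarith)]
      with w hw
    exact hsq w hw.1 (by have := hw.2; linarith)
  have hEq : Set.EqOn g 0 (interior (strip z)) :=
    hg'.eqOn_zero_of_preconnected_of_eventuallyEq_zero hconn hcm hev
  have hEq' : Set.EqOn g 0 (strip z) := by
    refine hEq.of_subset_closure hg continuousOn_const interior_subset ?_
    rw [hint, strip_eq_of_pos hz, Complex.closure_preimage_im, closure_Ioo hz.ne]
  exact hEq' (by rw [strip_eq_of_pos hz]; exact ⟨hz.le, le_rfl⟩)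

theorem strip_neg (z : ℂ) : strip (-z) = Neg.neg ⁻¹' strip z := by
  ext y
  simp only [strip, Set.mem_ofPred_eq, Set.mem_preimage, Complex.neg_im, Set.mem_uIcc]
  constructor <;> rintro (h | h)
  · right; constructor <;> linarith
  · left; constructor <;> linarith
  · right; constructor <;> linarith
  · left; constructor <;> linarith

theorem scalar_unique {g : ℂ → ℂ} {z : ℂ}
    (hg : ContinuousOn g (strip z)) (hg' : AnalyticOnNhd ℂ g (interior (strip z)))
    (h0 : ∀ t : ℝ, g t = 0) : g z = 0 := by
  rcases lt_trichotomy z.im 0 with hz | hz | hz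
  · have hs := strip_neg z
    have hi : interior (strip (-z)) = Neg.neg ⁻¹' interior (strip z) := by
      rw [hs]
      exact ((Homeomorph.neg ℂ).preimage_interior (strip z)).symm
    have := scalar_unique_of_pos (g := fun w => g (-w)) (z := -z) (by simpa using hz)
      (hg.comp continuousOn_neg (by rw [hs]; exact fun _ h => h))
      (hg'.comp (analyticOnNhd_id.neg) (by rw [hi]; exact fun _ h => h))
      (fun t => by simpa using h0 (-t))
    simpa using this
  · have : z = ((z.re : ℝ) : ℂ) := Complex.ext (by simp) (by simp [hz])
    rw [this, h0]
  · exact scalar_unique_of_pos hz hg hg' h0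

theorem vector_unique {E : Type*} [NormedAddCommGroup E] [NormedSpace ℂ E] {f : ℂ → E} {z : ℂ}
    (hf : ContinuousOn f (strip z)) (hf' : AnalyticOnNhd ℂ f (interior (strip z)))
    (h0 : ∀ t : ℝ, f t = 0) : f z = 0 := by
  refine SeparatingDual.eq_zero_of_forall_dual_eq_zero (R := ℂ) fun φ => ?_
  exact scalar_unique (g := fun u => φ (f u)) (φ.continuous.comp_continuousOn hf)
    (φ.comp_analyticOnNhd hf') (fun t => by simp [h0])

/-- The function `f` in the definition of `α_z` has a unique value at `z`, so that the graph of
`α_z` is the set it is meant to be. -/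
theorem cont_graph {E : Type*} [NormedAddCommGroup E] [NormedSpace ℂ E]
    (α : ℝ → E →L[ℂ] E) (z : ℂ) : (cont α z).graph = contGraph α z := by
  refine Submodule.toLinearPMap_graph_eq _ ?_
  rintro ⟨a, b⟩ ⟨f, hf, hf', hfα, hfz⟩ (rfl : a = 0)
  rw [← hfz]
  exact vector_unique hf hf' fun t => by simp [hfα]

/-- The same for the strict continuation. -/
theorem strictCont_graph {A : Type*} [NonUnitalCStarAlgebra A] (α : ℝ → A →L[ℂ] A) (z : ℂ) :
    (strictCont α z).graph = strictContGraph α z := by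
  refine Submodule.toLinearPMap_graph_eq _ ?_
  rintro ⟨a, b⟩ ⟨f, hf, hf', hfα, hfz⟩ (rfl : a = 0)
  rw [strictContinuousOn_iff] at hf
  change b = 0
  rw [← show f z = b from hfz]
  have hz : ∀ t : ℝ, f t = 0 := fun t => by simp [hfα]
  let L : A → 𝓜(ℂ, A) →L[ℂ] A := fun c => LinearMap.mkContinuous
    { toFun := fun x => x.fst c, map_add' := fun _ _ => rfl, map_smul' := fun _ _ => rfl } ‖c‖
    (fun x => by
      have := x.fst.le_opNorm c
      rw [DoubleCentralizer.norm_fst, mul_comm] at this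
      exact this)
  let R : A → 𝓜(ℂ, A) →L[ℂ] A := fun c => LinearMap.mkContinuous
    { toFun := fun x => x.snd c, map_add' := fun _ _ => rfl, map_smul' := fun _ _ => rfl } ‖c‖
    (fun x => by
      have := x.snd.le_opNorm c
      rw [DoubleCentralizer.norm_snd, mul_comm] at this
      exact this)
  refine DoubleCentralizer.ext _ _ _ _ (Prod.ext ?_ ?_) <;>
    refine ContinuousLinearMap.ext fun c => ?_
  · exact vector_unique (f := fun u => (f u).fst c) (hf c).1 ((L c).comp_analyticOnNhd hf')
      (fun t => by simp [hz])
  · exact vector_unique (f := fun u => (f u).snd c) (hf c).2 ((R c).comp_analyticOnNhd hf')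
      (fun t => by simp [hz])

/-! ### The strict extensions are well defined -/

theorem eq_of_forall_mul_left {A : Type*} [NonUnitalCStarAlgebra A] {x y : A}
    (h : ∀ c : A, c * x = c * y) : x = y := by
  have h1 : star (x - y) * (x - y) = 0 := by rw [mul_sub, h, sub_self]
  exact sub_eq_zero.1 (CStarRing.star_mul_self_eq_zero_iff _ |>.1 h1)

theorem fst_mul {A : Type*} [NonUnitalCStarAlgebra A] (x : 𝓜(ℂ, A)) (a b : A) :
    x.fst (a * b) = x.fst a * b :=
  eq_of_forall_mul_left fun c => by
    rw [← x.central, ← mul_assoc, x.central, mul_assoc]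

/-- Existence and uniqueness of the strict extension of an operator `ρ` with
`l(b) ρ(a) = ρ(b a)` and `ρ(a) r(b) = ρ(a b)` for surjective `l`, `r`. -/
theorem existsUnique_strictExtension {A : Type*} [NonUnitalCStarAlgebra A]
    (ρ l l' r r' : A →L[ℂ] A) (hl : ∀ a, l (l' a) = a) (hr : ∀ a, r (r' a) = a)
    (hlρ : ∀ a b, l b * ρ a = ρ (b * a)) (hrρ : ∀ a b, ρ a * r b = ρ (a * b)) :
    ∃! θ : 𝓜(ℂ, A) →ₗ[ℂ] 𝓜(ℂ, A), IsStrictExtension ρ θ := by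
  refine existsUnique_of_exists_of_unique ?_ ?_
  · let θ : 𝓜(ℂ, A) →ₗ[ℂ] 𝓜(ℂ, A) :=
      { toFun := fun x =>
          { fst := ρ ∘L x.fst ∘L r'
            snd := ρ ∘L x.snd ∘L l'
            central := fun a b => by
              have h1 := hrρ (x.snd (l' a)) (r' b)
              have h2 := hlρ (x.fst (r' b)) (l' a)
              rw [hr] at h1
              rw [hl, ← x.central] at h2
              exact h1.trans h2.symm }
        map_add' := fun x y => by
          refine DoubleCentralizer.ext _ _ _ _ (Prod.ext ?_ ?_) <;> ext c <;> simp
        map_smul' := fun k x => by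
          refine DoubleCentralizer.ext _ _ _ _ (Prod.ext ?_ ?_) <;> ext c <;> simp }
    refine ⟨θ, ?_, ?_⟩
    · intro a
      refine DoubleCentralizer.ext _ _ _ _ (Prod.ext ?_ ?_) <;>
        refine ContinuousLinearMap.ext fun c => ?_
      · change ρ (a * r' c) = ρ a * c
        rw [← hrρ, hr]
      · change ρ (l' c * a) = c * ρ a
        rw [← hlρ, hl]
    · intro s _
      let _ := strictTopology A
      have hid := strictContinuousOn_iff.1
        (show StrictContinuousOn (fun x : 𝓜(ℂ, A) => x) s from continuousOn_id)
      refine (strictContinuousOn_iff (f := θ)).2 fun b => ⟨?_, ?_⟩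
      · exact ρ.continuous.comp_continuousOn (hid (r' b)).1
      · exact ρ.continuous.comp_continuousOn (hid (l' b)).2
  · intro θ₁ θ₂ h₁ h₂
    let _ := CStarAlgebra.spectralOrder A
    let _ := CStarAlgebra.spectralOrderedRing A
    have hE := CStarAlgebra.increasingApproximateUnit A
    set e := CStarAlgebra.approximateUnit A
    ext1 x
    set s : Set 𝓜(ℂ, A) := Metric.closedBall 0 ‖x‖ with hs
    have hsb : Bornology.IsBounded s := Metric.isBounded_closedBall
    have hmem : ∀ᶠ u in e, ((x.fst u : A) : 𝓜(ℂ, A)) ∈ s := by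
      filter_upwards [hE.eventually_norm] with u hu
      rw [hs, mem_closedBall_zero_iff]
      have hcoe : ‖((x.fst u : A) : 𝓜(ℂ, A))‖ ≤ ‖x.fst u‖ := by
        rw [← DoubleCentralizer.norm_fst, DoubleCentralizer.coe_fst]
        exact ContinuousLinearMap.opNorm_mul_apply_le ℂ A _
      calc _ ≤ ‖x.fst u‖ := hcoe
        _ ≤ ‖x.fst‖ * ‖u‖ := x.fst.le_opNorm u
        _ ≤ ‖x‖ * 1 := by rw [DoubleCentralizer.norm_fst]; gcongr
        _ = ‖x‖ := mul_one _
    have hlim : Filter.Tendsto (fun u => ((x.fst u : A) : 𝓜(ℂ, A))) e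
        (@nhds _ (strictTopology A) x) := by
      rw [strictTopology, nhds_induced, Filter.tendsto_comap_iff]
      refine Filter.Tendsto.prodMk_nhds (tendsto_pi_nhds.2 fun b => ?_)
        (tendsto_pi_nhds.2 fun b => ?_)
      · change Filter.Tendsto (fun u => x.fst u * b) e _
        simp_rw [← fst_mul]
        exact (x.fst.continuous.tendsto b).comp (hE.tendsto_mul_right b)
      · change Filter.Tendsto (fun u => b * x.fst u) e _
        simp_rw [← x.central]
        exact hE.tendsto_mul_left (x.snd b)
    have main : ∀ θ, IsStrictExtension ρ θ → ∀ b : A,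
        Filter.Tendsto (fun u => ((ρ (x.fst u) : A) : 𝓜(ℂ, A)).fst b) e (nhds ((θ x).fst b)) ∧
        Filter.Tendsto (fun u => ((ρ (x.fst u) : A) : 𝓜(ℂ, A)).snd b) e (nhds ((θ x).snd b)) := by
      intro θ h b
      have hc := h.continuousOn s hsb
      let _ := strictTopology A
      have hcb := (strictContinuousOn_iff (f := θ)).1 hc b
      have hw : Filter.Tendsto (fun u => ((x.fst u : A) : 𝓜(ℂ, A))) e (nhdsWithin x s) :=
        tendsto_nhdsWithin_iff.2 ⟨hlim, hmem⟩
      have hx : x ∈ s := mem_closedBall_zero_iff.2 le_rfl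
      refine ⟨?_, ?_⟩
      · refine ((hcb.1 x hx).tendsto.comp hw).congr fun u => ?_
        simp only [Function.comp, h.extends_apply]
      · refine ((hcb.2 x hx).tendsto.comp hw).congr fun u => ?_
        simp only [Function.comp, h.extends_apply]
    have : e.NeBot := hE.neBot
    refine DoubleCentralizer.ext _ _ _ _ (Prod.ext ?_ ?_) <;>
      refine ContinuousLinearMap.ext fun b => ?_
    · exact tendsto_nhds_unique (main θ₁ h₁ b).1 (main θ₂ h₂ b).1
    · exact tendsto_nhds_unique (main θ₁ h₁ b).2 (main θ₂ h₂ b).2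

theorem IsRep.apply_neg {E : Type*} [NormedAddCommGroup E] [NormedSpace ℂ E]
    {α : ℝ → E →L[ℂ] E} (h : IsRep α) (t : ℝ) (a : E) : α t (α (-t) a) = a := by
  have := DFunLike.congr_fun (h.add t (-t)) a
  simpa [h.zero] using this.symm

theorem strictExtension_spec {A : Type*} [NonUnitalCStarAlgebra A] {α : ℝ → A →L[ℂ] A}
    (h : IsSemiMultiplicative α) (t : ℝ) :
    IsStrictExtension (α t) (strictExtension (α t)) ∧
      ∀ θ, IsStrictExtension (α t) θ → θ = strictExtension (α t) := by
  obtain ⟨αl, αr, hl, hr, hα⟩ := h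
  have hex := existsUnique_strictExtension (α t) (αl t) (αl (-t)) (αr t) (αr (-t))
    (hl.apply_neg t) (hr.apply_neg t) (fun a b => (hα t a b).1) (fun a b => (hα t a b).2)
  have hsp : IsStrictExtension (α t) (strictExtension (α t)) := Classical.epsilon_spec hex.exists
  exact ⟨hsp, fun θ hθ => hex.unique hθ hsp⟩

theorem strictExtension_comp_spec {A : Type*} [NonUnitalCStarAlgebra A] {α β : ℝ → A →L[ℂ] A}
    (h : IsSemiMultiplicative α) (h' : IsSemiMultiplicative β) (t : ℝ) :
    IsStrictExtension (α t ∘L β t) (strictExtension (α t ∘L β t)) ∧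
      ∀ θ, IsStrictExtension (α t ∘L β t) θ → θ = strictExtension (α t ∘L β t) := by
  obtain ⟨αl, αr, hl, hr, hα⟩ := h
  obtain ⟨βl, βr, hl', hr', hβ⟩ := h'
  have hex := existsUnique_strictExtension (α t ∘L β t) (αl t ∘L βl t) (βl (-t) ∘L αl (-t))
    (αr t ∘L βr t) (βr (-t) ∘L αr (-t))
    (fun a => by simp [hl'.apply_neg t, hl.apply_neg t])
    (fun a => by simp [hr'.apply_neg t, hr.apply_neg t])
    (fun a b => by simp [(hα t _ _).1, (hβ t _ _).1])
    (fun a b => by simp [(hα t _ _).2, (hβ t _ _).2])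
  have hsp : IsStrictExtension (α t ∘L β t) (strictExtension (α t ∘L β t)) :=
    Classical.epsilon_spec hex.exists
  exact ⟨hsp, fun θ hθ => hex.unique hθ hsp⟩

end OneParam

end

open scoped MultiplierAlgebra

noncomputable section

namespace OneParam

open Filter Topology MeasureTheory Metric Set

/-! ### Holomorphic parameter integrals -/

theorem differentiableOn_integral_of_dominated {E : Type*} [NormedAddCommGroup E]
    [NormedSpace ℂ E] [CompleteSpace E] {F : ℂ → ℝ → E} {U : Set ℂ} (hU : IsOpen U)
    (hm : ∀ u ∈ U, AEStronglyMeasurable (F u) volume)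
    (hd : ∀ t, DifferentiableOn ℂ (fun u => F u t) U)
    (hb : ∀ u₀ ∈ U, ∃ h : ℝ → ℝ, Integrable h ∧ ∀ᶠ u in 𝓝 u₀, ∀ t, ‖F u t‖ ≤ h t) :
    DifferentiableOn ℂ (fun u => ∫ t, F u t) U := by
  intro u₀ hu₀
  obtain ⟨h, hh, hbd⟩ := hb u₀ hu₀
  obtain ⟨R', hR', hball⟩ := Metric.mem_nhds_iff.1 (inter_mem (hU.mem_nhds hu₀) hbd)
  set R := R' / 3 with hR
  have hRpos : 0 < R := by positivity
  have hsub : ∀ v ∈ ball u₀ R, closedBall v R ⊆ ball u₀ R' := fun v hv w hw => by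
    have h1 := mem_ball.1 hv
    have h2 := mem_closedBall.1 hw
    have h3 := dist_triangle w v u₀
    exact mem_ball.2 (by linarith)
  have hdiff : ∀ t, ∀ v ∈ ball u₀ R, HasDerivAt (fun u => F u t) (deriv (fun u => F u t) v) v :=
    fun t v hv => ((hd t).differentiableAt (hU.mem_nhds
      (hball (hsub v hv (mem_closedBall_self hRpos.le))).1)).hasDerivAt
  refine (hasDerivAt_integral_of_dominated_loc_of_deriv_le (bound := fun t => h t / R)
    (F' := fun v t => deriv (fun u => F u t) v)
    (ball_mem_nhds u₀ hRpos) ?_ ?_ ?_ ?_ (hh.div_const R) ?_).2.differentiableAt.differentiableWithinAt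
  · filter_upwards [hU.mem_nhds hu₀] with u hu using hm u hu
  · exact hh.mono' (hm u₀ hu₀) (Eventually.of_forall hbd.self_of_nhds)
  · have hmem : ∀ n : ℕ, u₀ + ((R / (n + 1) : ℝ) : ℂ) ∈ U := by
      intro n
      refine (hball (hsub u₀ (mem_ball_self hRpos) ?_)).1
      rw [mem_closedBall, dist_self_add_left, Complex.norm_real, Real.norm_of_nonneg (by positivity)]
      exact div_le_self hRpos.le (by linarith [n.cast_nonneg (α := ℝ)])
    refine aestronglyMeasurable_of_tendsto_ae (u := atTop)
      (f := fun (n : ℕ) t => ((R / (n + 1) : ℝ) : ℂ)⁻¹ •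
        (F (u₀ + ((R / (n + 1) : ℝ) : ℂ)) t - F u₀ t)) ?_ ?_
    · exact fun n => ((hm _ (hmem n)).sub (hm u₀ hu₀)).const_smul _
    · refine Eventually.of_forall fun t => ?_
      have h1 := hasDerivAt_iff_tendsto_slope_zero.1 (hdiff t u₀ (mem_ball_self hRpos))
      refine h1.comp (tendsto_nhdsWithin_iff.2 ⟨?_, Eventually.of_forall fun n => ?_⟩)
      · have h2 : Tendsto (fun n : ℕ => R / ((n : ℝ) + 1)) atTop (𝓝 0) :=
          tendsto_const_nhds.div_atTop
            (tendsto_atTop_add_const_right _ _ tendsto_natCast_atTop_atTop)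
        exact (Complex.continuous_ofReal.tendsto' 0 0 (by simp)).comp h2
      · have : (R / ((n : ℝ) + 1)) ≠ 0 := by positivity
        exact Complex.ofReal_ne_zero.2 this
  · refine Eventually.of_forall fun t v hv => ?_
    refine Complex.norm_deriv_le_of_forall_mem_sphere_norm_le hRpos
      (DifferentiableOn.diffContOnCl ?_) fun w hw => ?_
    · rw [closure_ball v hRpos.ne']
      exact (hd t).mono fun w hw => (hball (hsub v hv hw)).1
    · exact (hball (hsub v hv (sphere_subset_closedBall hw))).2 t
  · exact Eventually.of_forall hdiff

/-! ### The Gaussian kernel -/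

/-- The Gaussian kernel, extended to complex arguments. -/
def gauss (r : ℝ) (w : ℂ) : ℂ := (√(r / Real.pi) : ℝ) * Complex.exp (-(r : ℂ) * w ^ 2)

theorem differentiable_gauss (r : ℝ) : Differentiable ℂ (gauss r) := by
  unfold gauss
  fun_prop

theorem norm_gauss (r : ℝ) (w : ℂ) :
    ‖gauss r w‖ = √(r / Real.pi) * Real.exp (-r * (w.re ^ 2 - w.im ^ 2)) := by
  rw [gauss, norm_mul, Complex.norm_real, Real.norm_of_nonneg (Real.sqrt_nonneg _),
    Complex.norm_exp]
  congr 2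
  simp [pow_two]

theorem norm_gauss_sub_le {r : ℝ} (hr : 0 < r) (t : ℝ) (u : ℂ) :
    ‖gauss r (t - u)‖ ≤
      √(r / Real.pi) * Real.exp (r * ‖u‖ ^ 2) * Real.exp (-(r / 2) * t ^ 2) := by
  rw [norm_gauss, mul_assoc, ← Real.exp_add, Complex.sq_norm, Complex.normSq_apply]
  gcongr
  simp only [Complex.sub_re, Complex.ofReal_re, Complex.sub_im, Complex.ofReal_im]
  nlinarith [mul_nonneg hr.le (sq_nonneg (t - 2 * u.re))]

theorem norm_gauss_ofReal (r t : ℝ) :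
    ‖gauss r t‖ = √(r / Real.pi) * Real.exp (-r * t ^ 2) := by
  simp [norm_gauss]

theorem continuous_gauss_sub (r : ℝ) (u : ℂ) : Continuous fun t : ℝ => gauss r (t - u) :=
  (differentiable_gauss r).continuous.comp (by fun_prop)

theorem integrable_gauss_sub {r : ℝ} (hr : 0 < r) (u : ℂ) :
    Integrable fun t : ℝ => gauss r (t - u) := by
  refine Integrable.mono' ((integrable_exp_neg_mul_sq (half_pos hr)).const_mul
    (√(r / Real.pi) * Real.exp (r * ‖u‖ ^ 2))) (continuous_gauss_sub r u).aestronglyMeasurable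
    (Eventually.of_forall fun t => norm_gauss_sub_le hr t u)

theorem sqrt_mul_sqrt_inv {r : ℝ} (hr : 0 < r) : √(r / Real.pi) * √(Real.pi / r) = 1 := by
  rw [← Real.sqrt_mul (by positivity)]
  have : r / Real.pi * (Real.pi / r) = 1 := by field_simp
  rw [this, Real.sqrt_one]

theorem integral_norm_gauss {r : ℝ} (hr : 0 < r) : ∫ t : ℝ, ‖gauss r t‖ = 1 := by
  simp_rw [norm_gauss_ofReal, integral_const_mul, integral_gaussian]
  exact sqrt_mul_sqrt_inv hr

theorem integral_gauss {r : ℝ} (hr : 0 < r) : ∫ t : ℝ, gauss r t = 1 := by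
  have : ∀ t : ℝ, gauss r t = ((‖gauss r t‖ : ℝ) : ℂ) := fun t => by
    rw [norm_gauss_ofReal, gauss]; push_cast; rfl
  rw [integral_congr_ae (Eventually.of_forall this), integral_complex_ofReal,
    integral_norm_gauss hr, Complex.ofReal_one]

theorem integrable_norm_gauss {r : ℝ} (hr : 0 < r) : Integrable fun t : ℝ => ‖gauss r t‖ := by
  simpa using (integrable_gauss_sub hr 0).norm

theorem norm_gauss_mul_sq_le {r : ℝ} (hr : 0 < r) (t : ℝ) :
    ‖gauss r t‖ * t ^ 2 ≤ (2 / r) * (√(r / Real.pi) * Real.exp (-(r / 2) * t ^ 2)) := by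
  have h1 : r / 2 * t ^ 2 * Real.exp (-(r / 2 * t ^ 2)) ≤ 1 := by
    rw [Real.exp_neg, ← div_eq_mul_inv, div_le_one (Real.exp_pos _)]
    linarith [Real.add_one_le_exp (r / 2 * t ^ 2)]
  have h2 : Real.exp (-r * t ^ 2) =
      Real.exp (-(r / 2 * t ^ 2)) * Real.exp (-(r / 2) * t ^ 2) := by
    rw [← Real.exp_add]; ring_nf
  rw [norm_gauss_ofReal, h2]
  calc _ = (2 / r) * (√(r / Real.pi) * Real.exp (-(r / 2) * t ^ 2)) *
        (r / 2 * t ^ 2 * Real.exp (-(r / 2 * t ^ 2))) := by field_simp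
    _ ≤ (2 / r) * (√(r / Real.pi) * Real.exp (-(r / 2) * t ^ 2)) * 1 := by gcongr
    _ = _ := mul_one _

theorem integrable_norm_gauss_mul_sq {r : ℝ} (hr : 0 < r) :
    Integrable fun t : ℝ => ‖gauss r t‖ * t ^ 2 := by
  refine Integrable.mono' (((integrable_exp_neg_mul_sq (half_pos hr)).const_mul
    (√(r / Real.pi))).const_mul (2 / r)) ?_ (Eventually.of_forall fun t => ?_)
  · refine Continuous.aestronglyMeasurable ?_
    have := continuous_gauss_sub r 0
    simp only [sub_zero] at this
    fun_prop
  · rw [Real.norm_of_nonneg (by positivity)]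
    exact norm_gauss_mul_sq_le hr t

theorem integral_norm_gauss_mul_sq_le {r : ℝ} (hr : 0 < r) :
    ∫ t : ℝ, ‖gauss r t‖ * t ^ 2 ≤ 4 / r := by
  calc _ ≤ ∫ t : ℝ, (2 / r) * (√(r / Real.pi) * Real.exp (-(r / 2) * t ^ 2)) :=
        integral_mono (integrable_norm_gauss_mul_sq hr)
          (((integrable_exp_neg_mul_sq (half_pos hr)).const_mul _).const_mul _)
          (norm_gauss_mul_sq_le hr)
    _ = (2 / r) * (√(r / Real.pi) * √(Real.pi / (r / 2))) := by
        rw [integral_const_mul, integral_const_mul, integral_gaussian]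
    _ = (2 / r) * √2 := by
        rw [← Real.sqrt_mul (by positivity)]
        congr 2
        field_simp
    _ ≤ (2 / r) * 2 := by
        gcongr
        rw [Real.sqrt_le_left (by norm_num)]
        norm_num
    _ = 4 / r := by ring

/-! ### Gaussian smearing of bounded continuous functions -/

section Smear

variable {E : Type*} [NormedAddCommGroup E] [NormedSpace ℂ E]

/-- The convolution of `φ` with the Gaussian kernel, evaluated at a complex point. -/
def smear (r : ℝ) (φ : ℝ → E) (u : ℂ) : E := ∫ t : ℝ, gauss r (t - u) • φ t

theorem integrable_gauss_smul {r : ℝ} (hr : 0 < r) {φ : ℝ → E} (hφ : Continuous φ) {M : ℝ}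
    (hM : ∀ t, ‖φ t‖ ≤ M) (u : ℂ) : Integrable fun t : ℝ => gauss r (t - u) • φ t :=
  (integrable_gauss_sub hr u).smul_bdd M hφ.aestronglyMeasurable (Eventually.of_forall hM)

theorem smear_add_ofReal (r : ℝ) (φ : ℝ → E) (u : ℂ) (s : ℝ) :
    smear r φ (u + s) = smear r (fun t => φ (t + s)) u := by
  rw [smear, ← integral_add_right_eq_self _ s, smear]
  congr 1 with t
  push_cast
  congr 2
  ring

theorem smear_zero (r : ℝ) (φ : ℝ → E) : smear r φ 0 = ∫ t : ℝ, gauss r t • φ t := by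
  simp [smear]

theorem smear_ofReal (r : ℝ) (φ : ℝ → E) (s : ℝ) :
    smear r φ s = ∫ t : ℝ, gauss r t • φ (t + s) := by
  have := smear_add_ofReal r φ 0 s
  rwa [zero_add, smear_zero] at this

theorem map_smear [CompleteSpace E] {F : Type*} [NormedAddCommGroup F] [NormedSpace ℂ F]
    [CompleteSpace F]
    (L : E →L[ℂ] F) {r : ℝ} (hr : 0 < r) {φ : ℝ → E} (hφ : Continuous φ) {M : ℝ}
    (hM : ∀ t, ‖φ t‖ ≤ M) (u : ℂ) : L (smear r φ u) = smear r (fun t => L (φ t)) u := by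
  rw [smear, ← L.integral_comp_comm (integrable_gauss_smul hr hφ hM u)]
  simp [smear]

theorem norm_smear_le {r : ℝ} (hr : 0 < r) {φ : ℝ → E} {M : ℝ}
    (hM : ∀ t, ‖φ t‖ ≤ M) (u : ℂ) : ‖smear r φ u‖ ≤ Real.exp (r * u.im ^ 2) * M := by
  have hM0 : 0 ≤ M := (norm_nonneg _).trans (hM 0)
  have hu : u = (u.im * Complex.I : ℂ) + (u.re : ℂ) := by
    rw [add_comm]; exact (Complex.re_add_im u).symm
  have hk : ∀ t : ℝ, ‖gauss r (t - u.im * Complex.I)‖ = Real.exp (r * u.im ^ 2) * ‖gauss r t‖ := by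
    intro t
    rw [norm_gauss, norm_gauss_ofReal, mul_left_comm, ← Real.exp_add]
    congr 2
    simp
    ring
  conv_lhs => rw [hu, smear_add_ofReal]
  calc _ ≤ ∫ t : ℝ, Real.exp (r * u.im ^ 2) * ‖gauss r t‖ * M := by
        refine norm_integral_le_of_norm_le (((integrable_norm_gauss hr).const_mul _).mul_const _)
          (Eventually.of_forall fun t => ?_)
        rw [norm_smul, hk]
        gcongr
        exact hM _
    _ = _ := by
        rw [integral_mul_const, integral_const_mul, integral_norm_gauss hr, mul_one]

theorem continuousOn_integral_gauss {r : ℝ} (hr : 0 < r) {p : ℂ → ℂ} (hp : Continuous p)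
    {Φ : ℂ → ℝ → E} {S : Set ℂ} {M : ℝ} (hc : ∀ u ∈ S, Continuous (Φ u))
    (hM : ∀ u ∈ S, ∀ t, ‖Φ u t‖ ≤ M) (hS : ∀ t, ContinuousOn (fun u => Φ u t) S) :
    ContinuousOn (fun u => ∫ t : ℝ, gauss r (t - p u) • Φ u t) S := by
  intro u₀ hu₀
  have hM0 : 0 ≤ M := (norm_nonneg _).trans (hM u₀ hu₀ 0)
  have hev : ∀ᶠ u in 𝓝[S] u₀, ‖p u‖ ≤ ‖p u₀‖ + 1 :=
    nhdsWithin_le_nhds ((hp.norm.tendsto u₀).eventually (ge_mem_nhds (by linarith)))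
  refine continuousWithinAt_of_dominated (bound := fun t =>
    √(r / Real.pi) * Real.exp (r * (‖p u₀‖ + 1) ^ 2) * Real.exp (-(r / 2) * t ^ 2) * M) ?_ ?_ ?_ ?_
  · filter_upwards [self_mem_nhdsWithin] with u hu
    exact ((continuous_gauss_sub r _).smul (hc u hu)).aestronglyMeasurable
  · filter_upwards [self_mem_nhdsWithin, hev] with u hu hpu
    refine Eventually.of_forall fun t => ?_
    rw [norm_smul]
    gcongr
    · exact (norm_gauss_sub_le hr t (p u)).trans (by gcongr)
    · exact hM u hu t
  · exact ((integrable_exp_neg_mul_sq (half_pos hr)).const_mul _).mul_const _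
  · refine Eventually.of_forall fun t => ContinuousWithinAt.smul ?_ (hS t u₀ hu₀)
    exact ((differentiable_gauss r).continuous.comp (by fun_prop)).continuousWithinAt

theorem differentiableOn_integral_gauss [CompleteSpace E] {r : ℝ} (hr : 0 < r) {p : ℂ → ℂ}
    (hp : Differentiable ℂ p)
    {Φ : ℂ → ℝ → E} {U : Set ℂ} (hU : IsOpen U) {M : ℝ} (hc : ∀ u ∈ U, Continuous (Φ u))
    (hM : ∀ u ∈ U, ∀ t, ‖Φ u t‖ ≤ M) (hd : ∀ t, DifferentiableOn ℂ (fun u => Φ u t) U) :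
    DifferentiableOn ℂ (fun u => ∫ t : ℝ, gauss r (t - p u) • Φ u t) U := by
  refine differentiableOn_integral_of_dominated hU ?_ ?_ ?_
  · exact fun u hu => ((continuous_gauss_sub r _).smul (hc u hu)).aestronglyMeasurable
  · intro t
    refine DifferentiableOn.smul (Differentiable.differentiableOn ?_) (hd t)
    exact (differentiable_gauss r).comp ((differentiable_const _).sub hp)
  · intro u₀ hu₀
    have hM0 : 0 ≤ M := (norm_nonneg _).trans (hM u₀ hu₀ 0)
    have hev : ∀ᶠ u in 𝓝 u₀, ‖p u‖ ≤ ‖p u₀‖ + 1 :=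
      (hp.continuous.norm.tendsto u₀).eventually (ge_mem_nhds (by linarith))
    refine ⟨fun t => √(r / Real.pi) * Real.exp (r * (‖p u₀‖ + 1) ^ 2) *
      Real.exp (-(r / 2) * t ^ 2) * M,
      ((integrable_exp_neg_mul_sq (half_pos hr)).const_mul _).mul_const _, ?_⟩
    filter_upwards [hU.mem_nhds hu₀, hev] with u hu hpu t
    rw [norm_smul]
    gcongr
    · exact (norm_gauss_sub_le hr t (p u)).trans (by gcongr)
    · exact hM u hu t

theorem differentiable_smear [CompleteSpace E] {r : ℝ} (hr : 0 < r) {φ : ℝ → E}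
    (hφ : Continuous φ) {M : ℝ} (hM : ∀ t, ‖φ t‖ ≤ M) : Differentiable ℂ (smear r φ) := by
  rw [← differentiableOn_univ]
  exact differentiableOn_integral_gauss hr differentiable_id isOpen_univ (fun _ _ => hφ)
    (fun _ _ => hM) (fun t => differentiableOn_const _)

theorem continuousOn_analytic_unique {f g : ℂ → E} {z : ℂ} (hf : ContinuousOn f (strip z))
    (hf' : DifferentiableOn ℂ f (interior (strip z))) (hg : ContinuousOn g (strip z))
    (hg' : DifferentiableOn ℂ g (interior (strip z))) [CompleteSpace E]
    (h : ∀ t : ℝ, f t = g t) {u : ℂ} (hu : u ∈ strip z) : f u = g u := by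
  have hsub : strip u ⊆ strip z := by
    intro v hv
    exact Set.uIcc_subset_uIcc Set.left_mem_uIcc hu hv
  refine sub_eq_zero.1 (vector_unique (f := fun v => f v - g v) (z := u) ?_ ?_ ?_)
  · exact (hf.sub hg).mono hsub
  · exact ((hf'.sub hg').mono (interior_mono hsub)).analyticOnNhd isOpen_interior
  · exact fun t => by simp [h]

theorem add_ofReal_mem_strip {z u : ℂ} (hu : u ∈ strip z) (t : ℝ) : u + t ∈ strip z := by
  simpa [strip] using hu

theorem ofReal_mem_strip (z : ℂ) (t : ℝ) : (t : ℂ) ∈ strip z := by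
  simp [strip]

theorem self_mem_strip (z : ℂ) : z ∈ strip z := by
  simp [strip]

theorem add_ofReal_mem_interior_strip {z u : ℂ} (hu : u ∈ interior (strip z)) (t : ℝ) :
    u + t ∈ interior (strip z) := by
  have h : (fun v : ℂ => v + t) ⁻¹' strip z = strip z := by
    ext v; simp [strip]
  have h2 := (Homeomorph.addRight (t : ℂ)).preimage_interior (strip z)
  rw [show (Homeomorph.addRight (t : ℂ)) ⁻¹' strip z = strip z from h] at h2
  rw [← h2] at hu
  exact hu

theorem comp_add_ofReal {f : ℂ → E} {z : ℂ} (hf : ContinuousOn f (strip z))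
    (hf' : DifferentiableOn ℂ f (interior (strip z))) (t : ℝ) :
    ContinuousOn (fun u => f (u + t)) (strip z) ∧
      DifferentiableOn ℂ (fun u => f (u + t)) (interior (strip z)) :=
  ⟨hf.comp (by fun_prop) fun _ hu => add_ofReal_mem_strip hu t,
    hf'.comp (by fun_prop) fun _ hu => add_ofReal_mem_interior_strip hu t⟩

/-- Shift of the contour of integration in the definition of `smear`. -/
theorem smear_eq_integral_shift [CompleteSpace E] {r : ℝ} (hr : 0 < r) {f : ℂ → E} {z : ℂ}
    (hf : ContinuousOn f (strip z))
    (hf' : DifferentiableOn ℂ f (interior (strip z))) {M : ℝ} (hM : ∀ u ∈ strip z, ‖f u‖ ≤ M) :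
    smear r (fun t => f t) z = smear r (fun t => f (z + t)) 0 := by
  have hcont : ∀ u ∈ strip z, Continuous fun t : ℝ => f (u + t) := fun u hu => by
    rw [← continuousOn_univ]
    exact hf.comp (by fun_prop) fun t _ => add_ofReal_mem_strip hu t
  have h0 : Continuous fun t : ℝ => f t := by simpa using hcont 0 (ofReal_mem_strip z 0)
  have hb := differentiable_smear hr h0 fun t => hM _ (ofReal_mem_strip z t)
  refine continuousOn_analytic_unique (z := z) (f := smear r fun t => f t)
    (g := fun u => smear r (fun t => f (u + t)) 0) hb.continuous.continuousOn
    hb.differentiableOn ?_ ?_ ?_ (self_mem_strip z)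
  · exact continuousOn_integral_gauss hr continuous_const hcont
      (fun u hu t => hM _ (add_ofReal_mem_strip hu t)) fun t => (comp_add_ofReal hf hf' t).1
  · exact differentiableOn_integral_gauss hr (differentiable_const 0) isOpen_interior
      (fun u hu => hcont u (interior_subset hu))
      (fun u hu t => hM _ (add_ofReal_mem_strip (interior_subset hu) t))
      fun t => (comp_add_ofReal hf hf' t).2
  · intro s
    rw [smear_ofReal, smear_zero]
    simp [add_comm]

theorem smear_const [CompleteSpace E] {r : ℝ} (hr : 0 < r) (x : E) (u : ℂ) :
    smear r (fun _ => x) u = x := by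
  rw [smear_eq_integral_shift hr (f := fun _ => x) continuousOn_const (differentiableOn_const _)
    (M := ‖x‖) (fun _ _ => le_rfl), smear_zero, integral_smul_const, integral_gauss hr, one_smul]

end Smear

section Approximation

variable {E : Type*} [NormedAddCommGroup E] [NormedSpace ℂ E]

theorem tendsto_exp_neg_sq_cocompact :
    Tendsto (fun x : ℝ => Real.exp (-x ^ 2)) (cocompact ℝ) (𝓝 0) := by
  simpa using tendsto_rpow_abs_mul_exp_neg_mul_sq_cocompact one_pos 0

theorem exists_weighted_modulus {φ : ℝ → E} (hφ : Continuous φ) {M : ℝ} (hM : ∀ t, ‖φ t‖ ≤ M)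
    {ε : ℝ} (hε : 0 < ε) :
    ∃ δ > 0, ∀ s : ℝ, |s| < δ → ∀ x : ℝ, Real.exp (-x ^ 2) * ‖φ (s + x) - φ x‖ ≤ ε := by
  have hM0 : 0 ≤ M := (norm_nonneg _).trans (hM 0)
  have hG : UniformContinuous fun x : ℝ => Real.exp (-x ^ 2) :=
    Continuous.uniformContinuous_of_tendsto_cocompact (by fun_prop) tendsto_exp_neg_sq_cocompact
  have hχ : UniformContinuous fun x : ℝ => ((Real.exp (-x ^ 2) : ℝ) : ℂ) • φ x := by
    refine Continuous.uniformContinuous_of_tendsto_cocompact (x := 0) (by fun_prop) ?_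
    refine squeeze_zero_norm (a := fun x => Real.exp (-x ^ 2) * M) (fun x => ?_)
      (by simpa using tendsto_exp_neg_sq_cocompact.mul_const M)
    rw [norm_smul, Complex.norm_real, Real.norm_of_nonneg (Real.exp_pos _).le]
    gcongr
    exact hM x
  obtain ⟨δ₁, hδ₁, h₁⟩ := Metric.uniformContinuous_iff.1 hG (ε / (2 * (M + 1))) (by positivity)
  obtain ⟨δ₂, hδ₂, h₂⟩ := Metric.uniformContinuous_iff.1 hχ (ε / 2) (by positivity)
  refine ⟨min δ₁ δ₂, lt_min hδ₁ hδ₂, fun s hs x => ?_⟩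
  have hd : dist (s + x) x = |s| := by simp
  have k₁ := (h₁ (a := s + x) (b := x) (by rw [hd]; exact hs.trans_le (min_le_left _ _))).le
  have k₂ := (h₂ (a := s + x) (b := x) (by rw [hd]; exact hs.trans_le (min_le_right _ _))).le
  rw [dist_eq_norm] at k₁ k₂
  have e : ((Real.exp (-x ^ 2) : ℝ) : ℂ) • (φ (s + x) - φ x) =
      (((Real.exp (-(s + x) ^ 2) : ℝ) : ℂ) • φ (s + x) - ((Real.exp (-x ^ 2) : ℝ) : ℂ) • φ x) -
      ((Real.exp (-(s + x) ^ 2) - Real.exp (-x ^ 2) : ℝ) : ℂ) • φ (s + x) := by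
    push_cast
    module
  calc Real.exp (-x ^ 2) * ‖φ (s + x) - φ x‖
      = ‖((Real.exp (-x ^ 2) : ℝ) : ℂ) • (φ (s + x) - φ x)‖ := by
        rw [norm_smul, Complex.norm_real, Real.norm_of_nonneg (Real.exp_pos _).le]
    _ ≤ ε / 2 + ε / (2 * (M + 1)) * M := by
        rw [e]
        refine (norm_sub_le _ _).trans (add_le_add k₂ ?_)
        rw [norm_smul, Complex.norm_real]
        gcongr
        exact hM _
    _ ≤ ε / 2 + ε / 2 := by
        gcongr
        rw [div_mul_eq_mul_div, div_le_div_iff₀ (by positivity) (by positivity)]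
        nlinarith
    _ = ε := by ring

theorem eventually_weighted_smear_sub_le [CompleteSpace E] {φ : ℝ → E} (hφ : Continuous φ) {M : ℝ}
    (hM : ∀ t, ‖φ t‖ ≤ M) {ε : ℝ} (hε : 0 < ε) :
    ∀ᶠ r : ℝ in atTop, ∀ x : ℝ, Real.exp (-x ^ 2) * ‖smear r φ x - φ x‖ ≤ ε := by
  have hM0 : 0 ≤ M := (norm_nonneg _).trans (hM 0)
  obtain ⟨δ, hδ, h⟩ := exists_weighted_modulus hφ hM (half_pos hε)
  set K := 2 * M / δ ^ 2 with hK
  have hbound : ∀ s x : ℝ, Real.exp (-x ^ 2) * ‖φ (s + x) - φ x‖ ≤ ε / 2 + K * s ^ 2 := by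
    intro s x
    by_cases hs : |s| < δ
    · exact (h s hs x).trans (by rw [le_add_iff_nonneg_right]; positivity)
    · have h1 : Real.exp (-x ^ 2) ≤ 1 := Real.exp_le_one_iff.2 (by nlinarith [sq_nonneg x])
      have h2 : ‖φ (s + x) - φ x‖ ≤ 2 * M :=
        (norm_sub_le _ _).trans (by linarith [hM (s + x), hM x])
      have h3 : δ ^ 2 ≤ s ^ 2 := by
        rw [← sq_abs s]
        exact pow_le_pow_left₀ hδ.le (not_lt.1 hs) 2
      have h4 : 2 * M ≤ K * s ^ 2 := by
        rw [hK, div_mul_eq_mul_div, le_div_iff₀ (by positivity)]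
        gcongr
      calc _ ≤ 1 * (2 * M) := by gcongr
        _ ≤ _ := by linarith
  have hlim : Tendsto (fun r : ℝ => ε / 2 + K * (4 / r)) atTop (𝓝 (ε / 2 + K * 0)) :=
    tendsto_const_nhds.add ((tendsto_const_nhds.div_atTop tendsto_id).const_mul K)
  filter_upwards [eventually_gt_atTop 0, hlim.eventually (gt_mem_nhds
    (show ε / 2 + K * 0 < ε by linarith))]
    with r hr hrε x
  have hi : Integrable fun t : ℝ => gauss r t • φ (t + x) := by
    simpa using integrable_gauss_smul hr (φ := fun t => φ (t + x)) (by fun_prop)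
      (fun t => hM _) 0
  have hi' : Integrable fun t : ℝ => gauss r t • φ x := by
    simpa using integrable_gauss_smul hr (φ := fun t => φ x) (by fun_prop) (fun t => hM _) 0
  have e : smear r φ x - φ x = ∫ t : ℝ, gauss r t • (φ (t + x) - φ x) := by
    simp_rw [smul_sub]
    rw [integral_sub hi hi', integral_smul_const, integral_gauss hr, one_smul, smear_ofReal]
  have hn : ‖((Real.exp (-x ^ 2) : ℝ) : ℂ) • (smear r φ x - φ x)‖ =
      Real.exp (-x ^ 2) * ‖smear r φ x - φ x‖ := by
    rw [norm_smul, Complex.norm_real, Real.norm_of_nonneg (Real.exp_pos _).le]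
  rw [← hn, e, ← integral_smul]
  calc _ ≤ ∫ t : ℝ, ‖gauss r t‖ * (ε / 2) + K * (‖gauss r t‖ * t ^ 2) := by
        refine norm_integral_le_of_norm_le (((integrable_norm_gauss hr).mul_const _).add
          ((integrable_norm_gauss_mul_sq hr).const_mul _)) (Eventually.of_forall fun t => ?_)
        rw [norm_smul, norm_smul, Complex.norm_real, Real.norm_of_nonneg (Real.exp_pos _).le]
        calc _ = ‖gauss r t‖ * (Real.exp (-x ^ 2) * ‖φ (t + x) - φ x‖) := by ring
          _ ≤ ‖gauss r t‖ * (ε / 2 + K * t ^ 2) := by gcongr; exact hbound t x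
          _ = _ := by ring
    _ = ε / 2 + K * ∫ t : ℝ, ‖gauss r t‖ * t ^ 2 := by
        rw [integral_add ((integrable_norm_gauss hr).mul_const _)
          ((integrable_norm_gauss_mul_sq hr).const_mul _), integral_mul_const,
          integral_norm_gauss hr, one_mul, integral_const_mul]
    _ ≤ ε / 2 + K * (4 / r) := by
        gcongr
        exact integral_norm_gauss_mul_sq_le hr
    _ ≤ ε := hrε.le

theorem tendsto_smear_ofReal [CompleteSpace E] {φ : ℝ → E} (hφ : Continuous φ) {M : ℝ}
    (hM : ∀ t, ‖φ t‖ ≤ M) (x : ℝ) : Tendsto (fun r : ℝ => smear r φ x) atTop (𝓝 (φ x)) := by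
  rw [Metric.tendsto_nhds]
  intro ε hε
  filter_upwards [eventually_weighted_smear_sub_le hφ hM
    (show 0 < Real.exp (-x ^ 2) * (ε / 2) by positivity)] with r hr
  rw [dist_eq_norm]
  have := le_of_mul_le_mul_left (hr x) (Real.exp_pos _)
  linarith

theorem tendsto_smear_zero [CompleteSpace E] {φ : ℝ → E} (hφ : Continuous φ) {M : ℝ}
    (hM : ∀ t, ‖φ t‖ ≤ M) : Tendsto (fun r : ℝ => smear r φ 0) atTop (𝓝 (φ 0)) := by
  simpa using tendsto_smear_ofReal hφ hM 0

/-- The maximum principle on a horizontal strip. -/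
theorem norm_le_of_boundary_strip {f : ℂ → E} (hf : Differentiable ℂ f) {z : ℂ} {K C : ℝ}
    (hK : ∀ u ∈ strip z, ‖f u‖ ≤ K) (h0 : ∀ x : ℝ, ‖f x‖ ≤ C)
    (h1 : ∀ x : ℝ, ‖f (z.im * Complex.I + x)‖ ≤ C) {u : ℂ} (hu : u ∈ strip z) : ‖f u‖ ≤ C := by
  have h0' : ∀ w : ℂ, w.im = 0 → ‖f w‖ ≤ C := fun w hw => by
    have : w = (w.re : ℂ) := Complex.ext (by simp) (by simp [hw])
    rw [this]; exact h0 _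
  have h1' : ∀ w : ℂ, w.im = z.im → ‖f w‖ ≤ C := fun w hw => by
    have : w = z.im * Complex.I + (w.re : ℂ) := Complex.ext (by simp) (by simp [hw])
    rw [this]; exact h1 _
  have hO : ∀ a b : ℝ, a < b → (Complex.im ⁻¹' Ioo a b ⊆ strip z) →
      ∃ c < Real.pi / (b - a), ∃ B, f =O[comap (_root_.abs ∘ Complex.re) atTop ⊓
        𝓟 (Complex.im ⁻¹' Ioo a b)] fun z ↦ Real.exp (B * Real.exp (c * |z.re|)) := by
    intro a b hab hsub
    refine ⟨0, div_pos Real.pi_pos (sub_pos.2 hab), 0, Asymptotics.IsBigO.of_bound K ?_⟩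
    filter_upwards [mem_inf_of_right (mem_principal_self _)] with w hw
    simpa using hK w (hsub hw)
  have hu' : u.im ∈ uIcc 0 z.im := hu
  rcases lt_trichotomy z.im 0 with hz | hz | hz
  · rw [uIcc_of_ge hz.le] at hu'
    refine PhragmenLindelof.horizontal_strip hf.diffContOnCl (hO _ _ hz fun w hw => ?_) h1' h0'
      hu'.1 hu'.2
    rw [strip, mem_ofPred_eq, uIcc_of_ge hz.le]
    exact Ioo_subset_Icc_self hw
  · rw [hz, uIcc_self] at hu'
    exact h0' u hu'
  · rw [uIcc_of_le hz.le] at hu'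
    refine PhragmenLindelof.horizontal_strip hf.diffContOnCl (hO _ _ hz fun w hw => ?_) h0' h1'
      hu'.1 hu'.2
    rw [strip, mem_ofPred_eq, uIcc_of_le hz.le]
    exact Ioo_subset_Icc_self hw

theorem im_sq_le_of_mem_strip {z u : ℂ} (hu : u ∈ strip z) : u.im ^ 2 ≤ z.im ^ 2 := by
  rcases Set.mem_uIcc.1 (show u.im ∈ uIcc 0 z.im from hu) with h | h <;> nlinarith [h.1, h.2]

theorem norm_cexp_neg_sq (u : ℂ) :
    ‖Complex.exp (-u ^ 2)‖ = Real.exp (-u.re ^ 2) * Real.exp (u.im ^ 2) := by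
  rw [Complex.norm_exp, ← Real.exp_add]
  congr 1
  simp [pow_two]
  ring

theorem norm_smear_le_of_boundary [CompleteSpace E] {r : ℝ} (hr : 0 < r) {φ ψ : ℝ → E}
    (hφ : Continuous φ) {M : ℝ} (hM : ∀ t, ‖φ t‖ ≤ M) (hM' : ∀ t, ‖ψ t‖ ≤ M) {z : ℂ}
    (h : ∀ x : ℝ, smear r φ (z.im * Complex.I + x) = smear r ψ x) {u : ℂ} (hu : u ∈ strip z) :
    ‖smear r φ u‖ ≤ M := by
  have hM0 : 0 ≤ M := (norm_nonneg _).trans (hM 0)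
  refine norm_le_of_boundary_strip (differentiable_smear hr hφ hM)
    (K := Real.exp (r * z.im ^ 2) * M) (fun v hv => ?_) (fun x => ?_) (fun x => ?_) hu
  · refine (norm_smear_le hr hM v).trans ?_
    exact mul_le_mul_of_nonneg_right (Real.exp_le_exp.2
      (mul_le_mul_of_nonneg_left (im_sq_le_of_mem_strip hv) hr.le)) hM0
  · simpa using norm_smear_le hr hM (x : ℂ)
  · rw [h]
    simpa using norm_smear_le hr hM' (x : ℂ)

theorem weighted_smear_sub_le [CompleteSpace E] {r r' : ℝ} (hr : 0 < r) (hr' : 0 < r')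
    {φ ψ : ℝ → E} (hφ : Continuous φ) {M : ℝ} (hM : ∀ t, ‖φ t‖ ≤ M) (hM' : ∀ t, ‖ψ t‖ ≤ M)
    {z : ℂ} (h : ∀ r : ℝ, 0 < r → ∀ x : ℝ, smear r φ (z.im * Complex.I + x) = smear r ψ x)
    {ε : ℝ} (h₁ : ∀ x : ℝ, Real.exp (-x ^ 2) * ‖smear r φ x - φ x‖ ≤ ε)
    (h₂ : ∀ x : ℝ, Real.exp (-x ^ 2) * ‖smear r' φ x - φ x‖ ≤ ε)
    (h₃ : ∀ x : ℝ, Real.exp (-x ^ 2) * ‖smear r ψ x - ψ x‖ ≤ ε)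
    (h₄ : ∀ x : ℝ, Real.exp (-x ^ 2) * ‖smear r' ψ x - ψ x‖ ≤ ε) {u : ℂ} (hu : u ∈ strip z) :
    ‖Complex.exp (-u ^ 2) • (smear r φ u - smear r' φ u)‖ ≤ Real.exp (z.im ^ 2) * (2 * ε) := by
  have hM0 : 0 ≤ M := (norm_nonneg _).trans (hM 0)
  have tri : ∀ {a b c : E} {k : ℝ}, 0 ≤ k → k * ‖a - c‖ ≤ ε → k * ‖b - c‖ ≤ ε →
      k * ‖a - b‖ ≤ 2 * ε := by
    intro a b c k hk h1 h2
    have : ‖a - b‖ ≤ ‖a - c‖ + ‖b - c‖ := by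
      rw [show a - b = (a - c) - (b - c) by abel]
      exact norm_sub_le _ _
    nlinarith [mul_le_mul_of_nonneg_left this hk]
  refine norm_le_of_boundary_strip (f := fun u => Complex.exp (-u ^ 2) •
    (smear r φ u - smear r' φ u)) (K := Real.exp (z.im ^ 2) * (M + M)) ?_ ?_ ?_ ?_ hu
  · exact Differentiable.smul (by fun_prop)
      ((differentiable_smear hr hφ hM).sub (differentiable_smear hr' hφ hM))
  · intro v hv
    have h5 : Real.exp (-v.re ^ 2) ≤ 1 := Real.exp_le_one_iff.2 (by nlinarith [sq_nonneg v.re])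
    have h6 : Real.exp (v.im ^ 2) ≤ Real.exp (z.im ^ 2) :=
      Real.exp_le_exp.2 (im_sq_le_of_mem_strip hv)
    rw [norm_smul, norm_cexp_neg_sq]
    calc _ ≤ 1 * Real.exp (z.im ^ 2) * (M + M) := by
          gcongr
          exact (norm_sub_le _ _).trans (add_le_add
            (norm_smear_le_of_boundary hr hφ hM hM' (h r hr) hv)
            (norm_smear_le_of_boundary hr' hφ hM hM' (h r' hr') hv))
      _ = _ := by rw [one_mul]
  · intro x
    have h5 := tri (Real.exp_pos _).le (h₁ x) (h₂ x)
    rw [norm_smul, norm_cexp_neg_sq]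
    have h6 : 1 ≤ Real.exp (z.im ^ 2) := Real.one_le_exp (sq_nonneg _)
    have h7 : 0 ≤ 2 * ε := le_trans (by positivity) h5
    simp only [Complex.ofReal_re, Complex.ofReal_im, ne_eq, OfNat.ofNat_ne_zero,
      not_false_eq_true, zero_pow, Real.exp_zero, mul_one]
    nlinarith
  · intro x
    have h5 := tri (Real.exp_pos _).le (h₃ x) (h₄ x)
    rw [norm_smul, norm_cexp_neg_sq, h r hr, h r' hr']
    simp only [Complex.add_re, Complex.mul_re, Complex.ofReal_re, Complex.I_re, mul_zero,
      Complex.ofReal_im, Complex.I_im, mul_one, sub_self, zero_add, Complex.add_im, Complex.mul_im,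
      add_zero]
    rw [mul_comm (Real.exp (-x ^ 2)), mul_assoc]
    gcongr

/-- Two bounded functions on the real line are the boundary values of an analytic function on a
strip as soon as their Gaussian smearings are. -/
theorem exists_tendsto_smear_strip [CompleteSpace E] {φ ψ : ℝ → E} (hφ : Continuous φ)
    (hψ : Continuous ψ) {M : ℝ} (hM : ∀ t, ‖φ t‖ ≤ M) (hM' : ∀ t, ‖ψ t‖ ≤ M) {z : ℂ}
    (h : ∀ r : ℝ, 0 < r → ∀ x : ℝ, smear r φ (z.im * Complex.I + x) = smear r ψ x) :
    ∃ f : ℂ → E, ContinuousOn f (strip z) ∧ DifferentiableOn ℂ f (interior (strip z)) ∧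
      ∀ u ∈ strip z, Tendsto (fun n : ℕ => smear (n + 1) φ u) atTop (𝓝 (f u)) := by
  set G : ℕ → ℂ → E := fun n u => Complex.exp (-u ^ 2) • smear (n + 1) φ u with hG
  have hpos : ∀ n : ℕ, (0 : ℝ) < n + 1 := fun n => by positivity
  have hto : Tendsto (fun n : ℕ => (n : ℝ) + 1) atTop atTop :=
    tendsto_atTop_add_const_right _ _ tendsto_natCast_atTop_atTop
  have hGd : ∀ n, Differentiable ℂ (G n) := fun n =>
    Differentiable.smul (by fun_prop) (differentiable_smear (hpos n) hφ hM)
  have hcau : UniformCauchySeqOn G atTop (strip z) := by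
    rw [Metric.uniformCauchySeqOn_iff]
    intro ε hε
    set η := ε / (4 * Real.exp (z.im ^ 2)) with hη
    have hη0 : 0 < η := by positivity
    obtain ⟨N, hN⟩ := eventually_atTop.1
      ((hto.eventually (eventually_weighted_smear_sub_le hφ hM hη0)).and
        (hto.eventually (eventually_weighted_smear_sub_le hψ hM' hη0)))
    refine ⟨N, fun m hm n hn u hu => ?_⟩
    rw [dist_eq_norm, hG, ← smul_sub]
    refine (weighted_smear_sub_le (hpos m) (hpos n) hφ hM hM' h (hN m hm).1 (hN n hn).1
      (hN m hm).2 (hN n hn).2 hu).trans_lt ?_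
    have : Real.exp (z.im ^ 2) * (2 * η) = ε / 2 := by
      rw [hη]; field_simp; norm_num
    linarith
  have hlim : ∀ u, ∃ y, u ∈ strip z → Tendsto (fun n => G n u) atTop (𝓝 y) := by
    intro u
    by_cases hu : u ∈ strip z
    · obtain ⟨y, hy⟩ := cauchySeq_tendsto_of_complete (hcau.cauchySeq hu)
      exact ⟨y, fun _ => hy⟩
    · exact ⟨0, fun h => absurd h hu⟩
  choose g hg using hlim
  have hunif := hcau.tendstoUniformlyOn_of_tendsto (fun u hu => hg u hu)
  have hgc : ContinuousOn g (strip z) :=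
    hunif.continuousOn (Frequently.of_forall fun n => (hGd n).continuous.continuousOn)
  have hgd : DifferentiableOn ℂ g (interior (strip z)) :=
    (hunif.mono interior_subset).tendstoLocallyUniformlyOn.differentiableOn
      (Eventually.of_forall fun n => (hGd n).differentiableOn) isOpen_interior
  have hexp : Differentiable ℂ fun u : ℂ => Complex.exp (u ^ 2) := by fun_prop
  refine ⟨fun u => Complex.exp (u ^ 2) • g u, hexp.continuous.continuousOn.smul hgc,
    hexp.differentiableOn.smul hgd, fun u hu => ?_⟩
  refine ((hg u hu).const_smul (Complex.exp (u ^ 2))).congr fun n => ?_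
  rw [hG, smul_smul, ← Complex.exp_add, add_neg_cancel, Complex.exp_zero, one_smul]

end Approximation

section Multiplier

variable {A : Type*} [NonUnitalCStarAlgebra A]

/-! ### Double centralizers -/

theorem eq_of_forall_mul_right {x y : A} (h : ∀ c : A, x * c = y * c) : x = y := by
  have h1 : (x - y) * star (x - y) = 0 := by rw [sub_mul, h, sub_self]
  exact sub_eq_zero.1 (CStarRing.mul_star_self_eq_zero_iff _ |>.1 h1)

theorem eq_of_fst_eq {x y : 𝓜(ℂ, A)} (h : ∀ d, x.fst d = y.fst d) : x = y := by
  refine DoubleCentralizer.ext _ _ _ _ (Prod.ext (ContinuousLinearMap.ext h) ?_)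
  refine ContinuousLinearMap.ext fun c => eq_of_forall_mul_right fun d => ?_
  rw [x.central, y.central, h]

theorem norm_fst_apply_le (x : 𝓜(ℂ, A)) (d : A) : ‖x.fst d‖ ≤ ‖x‖ * ‖d‖ := by
  simpa [DoubleCentralizer.norm_fst] using x.fst.le_opNorm d

theorem norm_snd_apply_le (x : 𝓜(ℂ, A)) (d : A) : ‖x.snd d‖ ≤ ‖x‖ * ‖d‖ := by
  simpa [DoubleCentralizer.norm_snd] using x.snd.le_opNorm d

theorem norm_le_of_fst_apply_le {x : 𝓜(ℂ, A)} {M : ℝ} (hM : 0 ≤ M)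
    (h : ∀ d, ‖x.fst d‖ ≤ M * ‖d‖) : ‖x‖ ≤ M := by
  rw [← DoubleCentralizer.norm_fst]
  exact x.fst.opNorm_le_bound hM h

/-- The left multiplication part of a multiplier, as a continuous linear map. -/
def fstCLM (A : Type*) [NonUnitalCStarAlgebra A] : 𝓜(ℂ, A) →L[ℂ] A →L[ℂ] A :=
  LinearMap.mkContinuous
    { toFun := fun x => x.fst, map_add' := fun _ _ => rfl, map_smul' := fun _ _ => rfl } 1
    fun x => by simp [DoubleCentralizer.norm_fst]

theorem fstCLM_apply (x : 𝓜(ℂ, A)) (d : A) : fstCLM A x d = x.fst d := rfl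

/-- A pair of maps with `r a * b = a * l b` is a double centralizer as soon as `l` is bounded. -/
theorem exists_doubleCentralizer {l r : A → A} (h : ∀ a b, r a * b = a * l b) {M : ℝ}
    (hM : 0 ≤ M) (hl : ∀ d, ‖l d‖ ≤ M * ‖d‖) :
    ∃ x : 𝓜(ℂ, A), (∀ d, x.fst d = l d) ∧ (∀ d, x.snd d = r d) ∧ ‖x‖ ≤ M := by
  have hr : ∀ d, ‖r d‖ ≤ M * ‖d‖ := by
    intro d
    rcases eq_or_lt_of_le (norm_nonneg (r d)) with h0 | h0
    · rw [← h0]; positivity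
    refine le_of_mul_le_mul_right ?_ h0
    calc ‖r d‖ * ‖r d‖ = ‖r d * star (r d)‖ := (CStarRing.norm_self_mul_star).symm
      _ = ‖d * l (star (r d))‖ := by rw [h]
      _ ≤ ‖d‖ * (M * ‖star (r d)‖) := (norm_mul_le _ _).trans (by gcongr; exact hl _)
      _ = M * ‖d‖ * ‖r d‖ := by rw [norm_star]; ring
  let L : A →L[ℂ] A := LinearMap.mkContinuous
    { toFun := l
      map_add' := fun b c => eq_of_forall_mul_left fun a => by
        rw [mul_add, ← h, ← h, ← h, mul_add]
      map_smul' := fun k b => eq_of_forall_mul_left fun a => by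
        rw [RingHom.id_apply, mul_smul_comm, ← h, ← h, mul_smul_comm] } M hl
  let R : A →L[ℂ] A := LinearMap.mkContinuous
    { toFun := r
      map_add' := fun b c => eq_of_forall_mul_right fun a => by
        rw [add_mul, h, h, h, add_mul]
      map_smul' := fun k b => eq_of_forall_mul_right fun a => by
        rw [RingHom.id_apply, smul_mul_assoc, h, h, smul_mul_assoc] } M hr
  let x : 𝓜(ℂ, A) := { fst := L, snd := R, central := h }
  exact ⟨x, fun _ => rfl, fun _ => rfl, norm_le_of_fst_apply_le hM hl⟩

/-- Bounded strict limits of multipliers exist. -/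
theorem exists_strict_limit {v : ℕ → 𝓜(ℂ, A)} {M : ℝ} (hM : ∀ n, ‖v n‖ ≤ M)
    (h₁ : ∀ d, ∃ y, Tendsto (fun n => (v n).fst d) atTop (𝓝 y))
    (h₂ : ∀ d, ∃ y, Tendsto (fun n => (v n).snd d) atTop (𝓝 y)) :
    ∃ x : 𝓜(ℂ, A), ‖x‖ ≤ M ∧ ∀ d, Tendsto (fun n => (v n).fst d) atTop (𝓝 (x.fst d)) ∧
      Tendsto (fun n => (v n).snd d) atTop (𝓝 (x.snd d)) := by
  choose l hl using h₁
  choose r hr using h₂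
  obtain ⟨x, hx₁, hx₂, hx⟩ := exists_doubleCentralizer (l := l) (r := r) (M := M)
    (fun a b => tendsto_nhds_unique ((hr a).mul_const b)
      (((hl b).const_mul a).congr fun n => ((v n).central a b).symm))
    ((norm_nonneg _).trans (hM 0))
    (fun d => le_of_tendsto (hl d).norm (Eventually.of_forall fun n =>
      (norm_fst_apply_le _ _).trans (by gcongr; exact hM n)))
  exact ⟨x, hx, fun d => ⟨by rw [hx₁]; exact hl d, by rw [hx₂]; exact hr d⟩⟩

/-- A bounded strictly analytic function with values in the multiplier algebra is norm analytic. -/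
theorem differentiableOn_of_fst_apply {f : ℂ → 𝓜(ℂ, A)} {U : Set ℂ} (hU : IsOpen U) {M : ℝ}
    (hM : ∀ u ∈ U, ‖f u‖ ≤ M) (hf : ∀ d, DifferentiableOn ℂ (fun u => (f u).fst d) U) :
    DifferentiableOn ℂ f U := by
  intro u₀ hu₀
  have hM0 : 0 ≤ M := (norm_nonneg _).trans (hM u₀ hu₀)
  obtain ⟨R', hR', hball⟩ := Metric.isOpen_iff.1 hU u₀ hu₀
  set R := R' / 3 with hR
  have hRpos : 0 < R := by positivity
  have hsub : ∀ v ∈ closedBall u₀ R, closedBall v R ⊆ U := fun v hv w hw => by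
    have h1 := mem_closedBall.1 hv
    have h2 := mem_closedBall.1 hw
    have h3 := dist_triangle w v u₀
    exact hball (mem_ball.2 (by linarith))
  have hlip : ∀ u ∈ closedBall u₀ R, ∀ v ∈ closedBall u₀ R, ‖f v - f u‖ ≤ M / R * ‖v - u‖ := by
    intro u hu v hv
    refine norm_le_of_fst_apply_le (by positivity) fun d => ?_
    have key := Convex.norm_image_sub_le_of_norm_deriv_le (f := fun u => (f u).fst d)
      (s := closedBall u₀ R) (C := M * ‖d‖ / R) (𝕜 := ℂ)
      (fun w hw => (hf d).differentiableAt (hU.mem_nhds (hsub w hw (mem_closedBall_self hRpos.le))))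
      (fun w hw => Complex.norm_deriv_le_of_forall_mem_sphere_norm_le hRpos
        (DifferentiableOn.diffContOnCl (by
          rw [closure_ball w hRpos.ne']
          exact (hf d).mono (hsub w hw)))
        (fun w' hw' => (norm_fst_apply_le _ _).trans (by
          gcongr
          exact hM _ (hsub w hw (sphere_subset_closedBall hw')))))
      (convex_closedBall _ _) hu hv
    change ‖(f v).fst d - (f u).fst d‖ ≤ _
    refine key.trans (le_of_eq (by ring))
  have hcont : ContinuousOn f (closedBall u₀ R) := by
    refine LipschitzOnWith.continuousOn (K := ⟨M / R, by positivity⟩)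
      (LipschitzOnWith.of_dist_le_mul fun u hu v hv => ?_)
    rw [dist_eq_norm, dist_eq_norm]
    exact hlip v hv u hu
  have hcauchy : ∀ w ∈ ball u₀ R,
      ((2 * Real.pi * Complex.I : ℂ)⁻¹ • ∮ ζ in C(u₀, R), (ζ - w)⁻¹ • f ζ) = f w := by
    intro w hw
    have hint : CircleIntegrable (fun ζ => (ζ - w)⁻¹ • f ζ) u₀ R := by
      have hinv : ContinuousOn (fun ζ => (ζ - w)⁻¹) (sphere u₀ R) := by
        refine ContinuousOn.inv₀ (by fun_prop) fun ζ hζ => sub_ne_zero.2 ?_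
        rintro rfl
        exact (mem_ball.1 hw).ne (mem_sphere.1 hζ)
      exact (hinv.smul (hcont.mono sphere_subset_closedBall)).circleIntegrable hRpos.le
    refine eq_of_fst_eq fun d => ?_
    have hsc := Complex.two_pi_I_inv_smul_circleIntegral_sub_inv_smul_of_differentiable_on_off_countable
      (f := fun u => (f u).fst d) countable_empty hw
      ((hf d).continuousOn.mono (hsub u₀ (mem_closedBall_self hRpos.le)))
      (fun x hx => (hf d).differentiableAt (hU.mem_nhds
        (hsub u₀ (mem_closedBall_self hRpos.le) (ball_subset_closedBall hx.1))))
    rw [← hsc]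
    let L : 𝓜(ℂ, A) →L[ℂ] A := (fstCLM A).flip d
    rw [← fstCLM_apply, ← ContinuousLinearMap.flip_apply]
    change L _ = _
    rw [map_smul]
    congr 1
    rw [circleIntegral, circleIntegral, ← L.intervalIntegral_comp_comm hint.out]
    refine intervalIntegral.integral_congr fun θ _ => ?_
    simp only [map_smul]
    rfl
  have hps := hasFPowerSeriesOn_cauchy_integral (f := f) (c := u₀) (R := ⟨R, hRpos.le⟩)
    ((hcont.mono sphere_subset_closedBall).circleIntegrable hRpos.le) hRpos
  refine (hps.differentiableOn.differentiableAt
    (Metric.isOpen_eball.mem_nhds (Metric.mem_eball_self hps.r_pos))).congr_of_eventuallyEq ?_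
    |>.differentiableWithinAt
  filter_upwards [ball_mem_nhds u₀ hRpos] with w hw
  exact (hcauchy w hw).symm

/-! ### Smearing of multiplier valued functions -/

/-- A bounded strictly continuous function on the real line. -/
structure IsStrictBounded (Φ : ℝ → 𝓜(ℂ, A)) (M : ℝ) : Prop where
  norm_le : ∀ t, ‖Φ t‖ ≤ M
  continuous_fst : ∀ d, Continuous fun t => (Φ t).fst d
  continuous_snd : ∀ d, Continuous fun t => (Φ t).snd d

theorem IsStrictBounded.norm_fst_le {Φ : ℝ → 𝓜(ℂ, A)} {M : ℝ} (h : IsStrictBounded Φ M) (d : A)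
    (t : ℝ) : ‖(Φ t).fst d‖ ≤ M * ‖d‖ :=
  (norm_fst_apply_le _ _).trans (by gcongr; exact h.norm_le t)

theorem IsStrictBounded.norm_snd_le {Φ : ℝ → 𝓜(ℂ, A)} {M : ℝ} (h : IsStrictBounded Φ M) (d : A)
    (t : ℝ) : ‖(Φ t).snd d‖ ≤ M * ‖d‖ :=
  (norm_snd_apply_le _ _).trans (by gcongr; exact h.norm_le t)

theorem IsStrictBounded.exists_smear {Φ : ℝ → 𝓜(ℂ, A)} {M : ℝ} (h : IsStrictBounded Φ M) {r : ℝ}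
    (hr : 0 < r) (u : ℂ) :
    ∃ x : 𝓜(ℂ, A), (∀ d, x.fst d = smear r (fun t => (Φ t).fst d) u) ∧
      (∀ d, x.snd d = smear r (fun t => (Φ t).snd d) u) ∧ ‖x‖ ≤ Real.exp (r * u.im ^ 2) * M := by
  have hM0 : 0 ≤ M := (norm_nonneg _).trans (h.norm_le 0)
  refine exists_doubleCentralizer (fun a b => ?_) (by positivity) (fun d => ?_)
  · have h1 := map_smear ((ContinuousLinearMap.mul ℂ A).flip b) hr (h.continuous_snd a)
      (h.norm_snd_le a) u
    have h2 := map_smear (ContinuousLinearMap.mul ℂ A a) hr (h.continuous_fst b)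
      (h.norm_fst_le b) u
    simp only [ContinuousLinearMap.flip_apply, ContinuousLinearMap.mul_apply'] at h1 h2
    rw [h1, h2]
    simp_rw [(Φ _).central]
  · rw [mul_assoc]
    exact norm_smear_le hr (h.norm_fst_le d) u

open Classical in
/-- The strict Gaussian smearing of a multiplier valued function. -/
def msmear (r : ℝ) (Φ : ℝ → 𝓜(ℂ, A)) (u : ℂ) : 𝓜(ℂ, A) :=
  if h : ∃ x : 𝓜(ℂ, A), (∀ d, x.fst d = smear r (fun t => (Φ t).fst d) u) ∧
    (∀ d, x.snd d = smear r (fun t => (Φ t).snd d) u) then h.choose else 0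

theorem IsStrictBounded.msmear_spec {Φ : ℝ → 𝓜(ℂ, A)} {M : ℝ} (h : IsStrictBounded Φ M) {r : ℝ}
    (hr : 0 < r) (u : ℂ) :
    (∀ d, (msmear r Φ u).fst d = smear r (fun t => (Φ t).fst d) u) ∧
      (∀ d, (msmear r Φ u).snd d = smear r (fun t => (Φ t).snd d) u) := by
  obtain ⟨x, hx₁, hx₂, -⟩ := h.exists_smear hr u
  have hex : ∃ x : 𝓜(ℂ, A), (∀ d, x.fst d = smear r (fun t => (Φ t).fst d) u) ∧
    (∀ d, x.snd d = smear r (fun t => (Φ t).snd d) u) := ⟨x, hx₁, hx₂⟩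
  rw [msmear, dif_pos hex]
  exact hex.choose_spec

theorem IsStrictBounded.msmear_fst {Φ : ℝ → 𝓜(ℂ, A)} {M : ℝ} (h : IsStrictBounded Φ M) {r : ℝ}
    (hr : 0 < r) (u : ℂ) (d : A) :
    (msmear r Φ u).fst d = smear r (fun t => (Φ t).fst d) u := (h.msmear_spec hr u).1 d

theorem IsStrictBounded.msmear_snd {Φ : ℝ → 𝓜(ℂ, A)} {M : ℝ} (h : IsStrictBounded Φ M) {r : ℝ}
    (hr : 0 < r) (u : ℂ) (d : A) :
    (msmear r Φ u).snd d = smear r (fun t => (Φ t).snd d) u := (h.msmear_spec hr u).2 d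

theorem IsStrictBounded.norm_msmear_le {Φ : ℝ → 𝓜(ℂ, A)} {M : ℝ} (h : IsStrictBounded Φ M)
    {r : ℝ} (hr : 0 < r) (u : ℂ) : ‖msmear r Φ u‖ ≤ Real.exp (r * u.im ^ 2) * M := by
  have hM0 : 0 ≤ M := (norm_nonneg _).trans (h.norm_le 0)
  refine norm_le_of_fst_apply_le (by positivity) fun d => ?_
  rw [h.msmear_fst hr, mul_assoc]
  exact norm_smear_le hr (h.norm_fst_le d) u

end Multiplier

/-! ### One-parameter representations -/

section Rep

variable {E : Type*} [NormedAddCommGroup E] [NormedSpace ℂ E] {α : ℝ → E →L[ℂ] E}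

theorem IsRep.add_apply (h : IsRep α) (s t : ℝ) (a : E) : α (s + t) a = α s (α t a) :=
  DFunLike.congr_fun (h.add s t) a

theorem IsRep.zero_apply (h : IsRep α) (a : E) : α 0 a = a := by
  rw [h.zero]; rfl

theorem IsRep.neg_apply (h : IsRep α) (t : ℝ) (a : E) : α (-t) (α t a) = a := by
  rw [← h.add_apply, neg_add_cancel, h.zero_apply]

theorem IsRep.norm_apply_le (h : IsRep α) (t : ℝ) (a : E) : ‖α t a‖ ≤ ‖a‖ :=
  ((α t).le_of_opNorm_le (h.norm_le t) a).trans (by rw [one_mul])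

theorem IsRep.continuous_comp (h : IsRep α) {x : ℝ → E} (hx : Continuous x) :
    Continuous fun t => α t (x t) := by
  rw [continuous_iff_continuousAt]
  intro s
  rw [ContinuousAt, tendsto_iff_norm_sub_tendsto_zero]
  have h1 : Tendsto (fun t => ‖x t - x s‖ + ‖α t (x s) - α s (x s)‖) (𝓝 s) (𝓝 (0 + 0)) :=
    (tendsto_iff_norm_sub_tendsto_zero.1 (hx.tendsto s)).add
      (tendsto_iff_norm_sub_tendsto_zero.1 ((h.continuous (x s)).tendsto s))
  rw [add_zero] at h1
  refine squeeze_zero (fun _ => norm_nonneg _) (fun t => ?_) h1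
  calc ‖α t (x t) - α s (x s)‖ = ‖α t (x t - x s) + (α t (x s) - α s (x s))‖ := by
        rw [map_sub]; congr 1; abel
    _ ≤ _ := (norm_add_le _ _).trans (by gcongr; exact h.norm_apply_le _ _)

theorem IsRep.smear_add [CompleteSpace E] (h : IsRep α) {r : ℝ} (hr : 0 < r) (a : E) (u : ℂ)
    (s : ℝ) : smear r (fun t => α t a) (u + s) = α s (smear r (fun t => α t a) u) := by
  rw [smear_add_ofReal, map_smear (α s) hr (h.continuous a) (fun t => h.norm_apply_le t a)]
  congr 1 with t
  rw [add_comm, h.add_apply]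

end Rep

/-! ### Semi-multiplicative representations -/

section SemiRep

variable {A : Type*} [NonUnitalCStarAlgebra A]

/-- A semi-multiplicative representation together with its left and right companions. -/
structure SemiRep (γ γl γr : ℝ → A →L[ℂ] A) : Prop where
  rep : IsRep γ
  left : IsRep γl
  right : IsRep γr
  mul_left : ∀ t a b, γl t b * γ t a = γ t (b * a)
  mul_right : ∀ t a b, γ t a * γr t b = γ t (a * b)

theorem exists_semiRep {γ : ℝ → A →L[ℂ] A} (h : IsRep γ) (hm : IsSemiMultiplicative γ) :
    ∃ γl γr, SemiRep γ γl γr := by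
  obtain ⟨γl, γr, hl, hr, hγ⟩ := hm
  exact ⟨γl, γr, h, hl, hr, fun t a b => (hγ t a b).1, fun t a b => (hγ t a b).2⟩

variable {γ γl γr : ℝ → A →L[ℂ] A}

theorem SemiRep.isSemiMultiplicative (h : SemiRep γ γl γr) : IsSemiMultiplicative γ :=
  ⟨γl, γr, h.left, h.right, fun t a b => ⟨h.mul_left t a b, h.mul_right t a b⟩⟩

theorem SemiRep.right_mul (h : SemiRep γ γl γr) (t : ℝ) (a b : A) :
    γr t (a * b) = γr t a * γr t b := by
  refine eq_of_forall_mul_left fun c => ?_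
  rw [← h.rep.apply_neg t c, h.mul_right, ← mul_assoc, ← mul_assoc, h.mul_right, h.mul_right]

theorem SemiRep.mul_apply (h : SemiRep γ γl γr) (t : ℝ) (a d : A) :
    γ t a * d = γ t (a * γr (-t) d) := by
  rw [← h.mul_right, h.right.apply_neg]

theorem SemiRep.apply_mul (h : SemiRep γ γl γr) (t : ℝ) (a d : A) :
    d * γ t a = γ t (γl (-t) d * a) := by
  rw [← h.mul_left, h.left.apply_neg]

theorem SemiRep.strictExtension_apply (h : SemiRep γ γl γr) (t : ℝ) (x : 𝓜(ℂ, A)) :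
    (∀ d, (strictExtension (γ t) x).fst d = γ t (x.fst (γr (-t) d))) ∧
      ∀ d, (strictExtension (γ t) x).snd d = γ t (x.snd (γl (-t) d)) := by
  let θ : 𝓜(ℂ, A) →ₗ[ℂ] 𝓜(ℂ, A) :=
    { toFun := fun x =>
        { fst := γ t ∘L x.fst ∘L γr (-t)
          snd := γ t ∘L x.snd ∘L γl (-t)
          central := fun a b => by
            change γ t (x.snd (γl (-t) a)) * b = a * γ t (x.fst (γr (-t) b))
            rw [h.mul_apply, h.apply_mul, x.central] }
      map_add' := fun x y => by
        refine DoubleCentralizer.ext _ _ _ _ (Prod.ext ?_ ?_) <;> ext c <;> simp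
      map_smul' := fun k x => by
        refine DoubleCentralizer.ext _ _ _ _ (Prod.ext ?_ ?_) <;> ext c <;> simp }
  have hθ : IsStrictExtension (γ t) θ := by
    refine ⟨fun a => eq_of_fst_eq fun c => (h.mul_apply t a c).symm, fun s _ => ?_⟩
    let _ := strictTopology A
    have hid := strictContinuousOn_iff.1
      (show StrictContinuousOn (fun x : 𝓜(ℂ, A) => x) s from continuousOn_id)
    refine (strictContinuousOn_iff (f := θ)).2 fun b => ⟨?_, ?_⟩
    · exact (γ t).continuous.comp_continuousOn (hid (γr (-t) b)).1
    · exact (γ t).continuous.comp_continuousOn (hid (γl (-t) b)).2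
  rw [← (strictExtension_spec h.isSemiMultiplicative t).2 θ hθ]
  exact ⟨fun _ => rfl, fun _ => rfl⟩

theorem SemiRep.ext_fst (h : SemiRep γ γl γr) (t : ℝ) (x : 𝓜(ℂ, A)) (d : A) :
    (strictExtension (γ t) x).fst d = γ t (x.fst (γr (-t) d)) := (h.strictExtension_apply t x).1 d

theorem SemiRep.ext_snd (h : SemiRep γ γl γr) (t : ℝ) (x : 𝓜(ℂ, A)) (d : A) :
    (strictExtension (γ t) x).snd d = γ t (x.snd (γl (-t) d)) := (h.strictExtension_apply t x).2 d

/-- The orbit of a multiplier under the extended representation. -/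
def orbit (γ : ℝ → A →L[ℂ] A) (x : 𝓜(ℂ, A)) (t : ℝ) : 𝓜(ℂ, A) := strictExtension (γ t) x

theorem SemiRep.orbit_fst (h : SemiRep γ γl γr) (t : ℝ) (x : 𝓜(ℂ, A)) (d : A) :
    (orbit γ x t).fst d = γ t (x.fst (γr (-t) d)) := h.ext_fst t x d

theorem SemiRep.orbit_zero (h : SemiRep γ γl γr) (x : 𝓜(ℂ, A)) : orbit γ x 0 = x :=
  eq_of_fst_eq fun d => by
    rw [h.orbit_fst, h.rep.zero_apply, neg_zero, h.right.zero_apply]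

theorem SemiRep.orbit_add (h : SemiRep γ γl γr) (s t : ℝ) (x : 𝓜(ℂ, A)) :
    orbit γ x (s + t) = orbit γ (orbit γ x t) s :=
  eq_of_fst_eq fun d => by
    rw [h.orbit_fst, h.orbit_fst, h.orbit_fst, h.rep.add_apply, neg_add_rev, h.right.add_apply]

theorem SemiRep.norm_orbit_le (h : SemiRep γ γl γr) (t : ℝ) (x : 𝓜(ℂ, A)) :
    ‖orbit γ x t‖ ≤ ‖x‖ := by
  refine norm_le_of_fst_apply_le (norm_nonneg _) fun d => ?_
  rw [h.orbit_fst]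
  refine (h.rep.norm_apply_le _ _).trans ((norm_fst_apply_le _ _).trans ?_)
  gcongr
  exact h.right.norm_apply_le _ _

theorem SemiRep.isStrictBounded_orbit (h : SemiRep γ γl γr) (x : 𝓜(ℂ, A)) :
    IsStrictBounded (orbit γ x) ‖x‖ where
  norm_le t := h.norm_orbit_le t x
  continuous_fst d := by
    simp_rw [h.orbit_fst]
    exact h.rep.continuous_comp (x.fst.continuous.comp
      ((h.right.continuous d).comp continuous_neg))
  continuous_snd d := by
    simp_rw [orbit, h.ext_snd]
    exact h.rep.continuous_comp (x.snd.continuous.comp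
      ((h.left.continuous d).comp continuous_neg))

theorem SemiRep.msmear_add (h : SemiRep γ γl γr) {r : ℝ} (hr : 0 < r) (x : 𝓜(ℂ, A)) (u : ℂ)
    (s : ℝ) : msmear r (orbit γ x) (u + s) = orbit γ (msmear r (orbit γ x) u) s :=
  eq_of_fst_eq fun d => by
    have hb := h.isStrictBounded_orbit x
    rw [hb.msmear_fst hr, h.orbit_fst, hb.msmear_fst hr, smear_add_ofReal,
      map_smear (γ s) hr (hb.continuous_fst _) (hb.norm_fst_le _)]
    congr 1 with t
    rw [add_comm, h.orbit_add, h.orbit_fst]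

/-! ### Strict analytic continuations -/

theorem mem_strictContGraph_of_fst {z : ℂ} {a b : 𝓜(ℂ, A)} {f : ℂ → 𝓜(ℂ, A)} {M : ℝ}
    (hM : ∀ u ∈ strip z, ‖f u‖ ≤ M) (h₁ : ∀ d, ContinuousOn (fun u => (f u).fst d) (strip z))
    (h₂ : ∀ d, ContinuousOn (fun u => (f u).snd d) (strip z))
    (hd : ∀ d, DifferentiableOn ℂ (fun u => (f u).fst d) (interior (strip z)))
    (h0 : ∀ t : ℝ, f t = orbit γ a t) (hz : f z = b) : (a, b) ∈ strictContGraph γ z :=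
  ⟨f, strictContinuousOn_iff.2 fun d => ⟨h₁ d, h₂ d⟩,
    (differentiableOn_of_fst_apply isOpen_interior (fun u hu => hM u (interior_subset hu))
      hd).analyticOnNhd isOpen_interior, h0, hz⟩

theorem SemiRep.witness_add (h : SemiRep γ γl γr) {z : ℂ} {a : 𝓜(ℂ, A)} {f : ℂ → 𝓜(ℂ, A)}
    (hc : ∀ d, ContinuousOn (fun u => (f u).fst d) (strip z))
    (hd : DifferentiableOn ℂ f (interior (strip z))) (h0 : ∀ t : ℝ, f t = orbit γ a t) {u : ℂ}
    (hu : u ∈ strip z) (t : ℝ) : f (u + t) = orbit γ (f u) t := by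
  have hd' : ∀ d, DifferentiableOn ℂ (fun u => (f u).fst d) (interior (strip z)) := fun d =>
    ((fstCLM A).flip d).differentiable.comp_differentiableOn hd
  refine eq_of_fst_eq fun d => ?_
  rw [h.orbit_fst]
  refine continuousOn_analytic_unique (z := z) (f := fun u => (f (u + t)).fst d)
    (g := fun u => γ t ((f u).fst (γr (-t) d))) (comp_add_ofReal (hc d) (hd' d) t).1
    (comp_add_ofReal (hc d) (hd' d) t).2 ((γ t).continuous.comp_continuousOn (hc _))
    ((γ t).differentiable.comp_differentiableOn (hd' _)) (fun s => ?_) hu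
  rw [← Complex.ofReal_add, h0, h0, add_comm, h.orbit_add, h.orbit_fst]

theorem SemiRep.witness_bounded (h : SemiRep γ γl γr) {z : ℂ} {a : 𝓜(ℂ, A)} {f : ℂ → 𝓜(ℂ, A)}
    (hc : ∀ d, ContinuousOn (fun u => (f u).fst d) (strip z))
    (hd : DifferentiableOn ℂ f (interior (strip z))) (h0 : ∀ t : ℝ, f t = orbit γ a t) :
    ∃ M : ℝ, ∀ u ∈ strip z, ‖f u‖ ≤ M := by
  have hmem : ∀ y ∈ uIcc 0 z.im, (y * Complex.I : ℂ) ∈ strip z := fun y hy => by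
    simpa [strip] using hy
  obtain ⟨M, hM⟩ := banach_steinhaus (g := fun y : uIcc 0 z.im => (f (y.1 * Complex.I)).fst)
    (fun d => by
      obtain ⟨C, hC⟩ := isCompact_uIcc.exists_bound_of_continuousOn (s := uIcc 0 z.im)
        (f := fun y : ℝ => (f (y * Complex.I)).fst d)
        ((hc d).comp (by fun_prop) hmem)
      exact ⟨C, fun y => hC y.1 y.2⟩)
  refine ⟨M, fun u hu => ?_⟩
  have e : u = u.im * Complex.I + u.re := by
    rw [add_comm]; exact (Complex.re_add_im u).symm
  rw [e, h.witness_add hc hd h0 (hmem _ hu)]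
  refine (h.norm_orbit_le _ _).trans ?_
  rw [← DoubleCentralizer.norm_fst]
  exact hM ⟨u.im, hu⟩

/-- The function defining a strict continuation, with its properties. -/
theorem SemiRep.exists_witness (h : SemiRep γ γl γr) {z : ℂ} {a b : 𝓜(ℂ, A)}
    (hab : (a, b) ∈ strictContGraph γ z) :
    ∃ (f : ℂ → 𝓜(ℂ, A)) (M : ℝ), (∀ u ∈ strip z, ‖f u‖ ≤ M) ∧
      (∀ d, ContinuousOn (fun u => (f u).fst d) (strip z)) ∧
      (∀ d, ContinuousOn (fun u => (f u).snd d) (strip z)) ∧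
      DifferentiableOn ℂ f (interior (strip z)) ∧ (∀ t : ℝ, f t = orbit γ a t) ∧ f z = b ∧
      ∀ t : ℝ, f (z + t) = orbit γ b t := by
  obtain ⟨f, hf, hf', h0, hz⟩ := hab
  rw [strictContinuousOn_iff] at hf
  have hc := fun d => (hf d).1
  obtain ⟨M, hM⟩ := h.witness_bounded hc hf'.differentiableOn h0
  refine ⟨f, M, hM, hc, fun d => (hf d).2, hf'.differentiableOn, h0, hz, fun t => ?_⟩
  rw [h.witness_add hc hf'.differentiableOn h0 (self_mem_strip z), show f z = b from hz]

theorem SemiRep.msmear_eq_of_mem (h : SemiRep γ γl γr) {z : ℂ} {a b : 𝓜(ℂ, A)}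
    (hab : (a, b) ∈ strictContGraph γ z) {r : ℝ} (hr : 0 < r) :
    msmear r (orbit γ a) z = msmear r (orbit γ b) 0 := by
  obtain ⟨f, M, hM, hc, -, hd, h0, -, hadd⟩ := h.exists_witness hab
  refine eq_of_fst_eq fun d => ?_
  rw [(h.isStrictBounded_orbit a).msmear_fst hr, (h.isStrictBounded_orbit b).msmear_fst hr]
  have key := smear_eq_integral_shift hr (f := fun u => (f u).fst d) (hc d)
    (((fstCLM A).flip d).differentiable.comp_differentiableOn hd) (M := M * ‖d‖)
    (fun u hu => (norm_fst_apply_le _ _).trans (by gcongr; exact hM u hu))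
  simpa only [h0, hadd] using key

theorem SemiRep.msmear_mem (h : SemiRep γ γl γr) (z : ℂ) (a : 𝓜(ℂ, A)) {r : ℝ} (hr : 0 < r) :
    (msmear r (orbit γ a) 0, msmear r (orbit γ a) z) ∈ strictContGraph γ z := by
  have hb := h.isStrictBounded_orbit a
  have h₁ : ∀ d, (fun u => (msmear r (orbit γ a) u).fst d) =
      smear r (fun t => (orbit γ a t).fst d) := fun d => funext fun u => hb.msmear_fst hr u d
  have h₂ : ∀ d, (fun u => (msmear r (orbit γ a) u).snd d) =
      smear r (fun t => (orbit γ a t).snd d) := fun d => funext fun u => hb.msmear_snd hr u d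
  have k₁ := fun d => differentiable_smear hr (hb.continuous_fst d) (hb.norm_fst_le d)
  have k₂ := fun d => differentiable_smear hr (hb.continuous_snd d) (hb.norm_snd_le d)
  refine mem_strictContGraph_of_fst (f := msmear r (orbit γ a))
    (M := Real.exp (r * z.im ^ 2) * ‖a‖) (fun u hu => ?_) (fun d => ?_) (fun d => ?_)
    (fun d => ?_) (fun t => ?_) rfl
  · refine (hb.norm_msmear_le hr u).trans ?_
    exact mul_le_mul_of_nonneg_right (Real.exp_le_exp.2
      (mul_le_mul_of_nonneg_left (im_sq_le_of_mem_strip hu) hr.le)) (norm_nonneg _)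
  · rw [h₁]; exact (k₁ d).continuous.continuousOn
  · rw [h₂]; exact (k₂ d).continuous.continuousOn
  · rw [h₁]; exact (k₁ d).differentiableOn
  · rw [← h.msmear_add hr, zero_add]

/-- Membership in the graph of a strict continuation can be tested on Gaussian smearings. -/
theorem SemiRep.mem_of_msmear_eq (h : SemiRep γ γl γr) {z : ℂ} {a b : 𝓜(ℂ, A)}
    (hab : ∀ r : ℝ, 0 < r → msmear r (orbit γ a) z = msmear r (orbit γ b) 0) :
    (a, b) ∈ strictContGraph γ z := by
  have ha := h.isStrictBounded_orbit a
  have hb := h.isStrictBounded_orbit b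
  set M := max ‖a‖ ‖b‖ with hMdef
  have haM : IsStrictBounded (orbit γ a) M :=
    ⟨fun t => (ha.norm_le t).trans (le_max_left _ _), ha.2, ha.3⟩
  have hbM : IsStrictBounded (fun t => orbit γ b (t - z.re)) M :=
    ⟨fun t => (hb.norm_le _).trans (le_max_right _ _),
      fun d => (hb.2 d).comp (continuous_sub_right _),
      fun d => (hb.3 d).comp (continuous_sub_right _)⟩
  have hM0 : 0 ≤ M := (norm_nonneg _).trans (le_max_left _ _)
  have hline : ∀ r : ℝ, 0 < r → ∀ x : ℝ, msmear r (orbit γ a) (z.im * Complex.I + x) =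
      msmear r (orbit γ b) ((x - z.re : ℝ) : ℂ) := by
    intro r hr x
    have e : (z.im * Complex.I + x : ℂ) = z + ((x - z.re : ℝ) : ℂ) :=
      Complex.ext (by simp) (by simp)
    rw [e, h.msmear_add hr, hab r hr, ← h.msmear_add hr, zero_add]
  have hshift : ∀ (φ : ℝ → A) (r x : ℝ), smear r φ ((x - z.re : ℝ) : ℂ) =
      smear r (fun t => φ (t - z.re)) x := by
    intro φ r x
    have := smear_add_ofReal r (fun t => φ (t - z.re)) ((x - z.re : ℝ) : ℂ) z.re
    rw [← Complex.ofReal_add, sub_add_cancel] at this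
    rw [this]
    simp
  have hfst : ∀ d, ∀ r : ℝ, 0 < r → ∀ x : ℝ,
      smear r (fun t => (orbit γ a t).fst d) (z.im * Complex.I + x) =
        smear r (fun t => (orbit γ b (t - z.re)).fst d) x := by
    intro d r hr x
    rw [← ha.msmear_fst hr, hline r hr, hb.msmear_fst hr, hshift]
  have hsnd : ∀ d, ∀ r : ℝ, 0 < r → ∀ x : ℝ,
      smear r (fun t => (orbit γ a t).snd d) (z.im * Complex.I + x) =
        smear r (fun t => (orbit γ b (t - z.re)).snd d) x := by
    intro d r hr x
    rw [← ha.msmear_snd hr, hline r hr, hb.msmear_snd hr, hshift]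
  have hpos : ∀ n : ℕ, (0 : ℝ) < n + 1 := fun n => by positivity
  have hto : Tendsto (fun n : ℕ => (n : ℝ) + 1) atTop atTop :=
    tendsto_atTop_add_const_right _ _ tendsto_natCast_atTop_atTop
  choose F hF₁ hF₂ hF₃ using fun d => exists_tendsto_smear_strip (haM.continuous_fst d)
    (hbM.continuous_fst d) (haM.norm_fst_le d) (hbM.norm_fst_le d) (hfst d)
  choose G hG₁ hG₂ hG₃ using fun d => exists_tendsto_smear_strip (haM.continuous_snd d)
    (hbM.continuous_snd d) (haM.norm_snd_le d) (hbM.norm_snd_le d) (hsnd d)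
  have hex : ∀ u, ∃ x : 𝓜(ℂ, A), u ∈ strip z →
      ‖x‖ ≤ M ∧ (∀ d, x.fst d = F d u) ∧ ∀ d, x.snd d = G d u := by
    intro u
    by_cases hu : u ∈ strip z
    · have t₁ : ∀ d, Tendsto (fun n : ℕ => (msmear (n + 1) (orbit γ a) u).fst d) atTop
          (𝓝 (F d u)) := fun d => (hF₃ d u hu).congr fun n => (ha.msmear_fst (hpos n) u d).symm
      have t₂ : ∀ d, Tendsto (fun n : ℕ => (msmear (n + 1) (orbit γ a) u).snd d) atTop
          (𝓝 (G d u)) := fun d => (hG₃ d u hu).congr fun n => (ha.msmear_snd (hpos n) u d).symm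
      obtain ⟨x, hx, hxl⟩ := exists_strict_limit (M := M) (fun n => by
        refine norm_le_of_fst_apply_le hM0 fun d => ?_
        rw [ha.msmear_fst (hpos n)]
        exact norm_smear_le_of_boundary (hpos n) (haM.continuous_fst d) (haM.norm_fst_le d)
          (hbM.norm_fst_le d) (hfst d _ (hpos n)) hu) (fun d => ⟨_, t₁ d⟩) (fun d => ⟨_, t₂ d⟩)
      exact ⟨x, fun _ => ⟨hx, fun d => tendsto_nhds_unique (hxl d).1 (t₁ d),
        fun d => tendsto_nhds_unique (hxl d).2 (t₂ d)⟩⟩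
    · exact ⟨0, fun h => absurd h hu⟩
  choose f hf using hex
  refine mem_strictContGraph_of_fst (f := f) (fun u hu => (hf u hu).1) (fun d => ?_) (fun d => ?_)
    (fun d => ?_) (fun t => ?_) ?_
  · exact (hF₁ d).congr fun u hu => (hf u hu).2.1 d
  · exact (hG₁ d).congr fun u hu => (hf u hu).2.2 d
  · exact (hF₂ d).congr fun u hu => (hf u (interior_subset hu)).2.1 d
  · refine eq_of_fst_eq fun d => ?_
    have ht := ofReal_mem_strip z t
    rw [(hf t ht).2.1 d]
    exact tendsto_nhds_unique (hF₃ d t ht)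
      ((tendsto_smear_ofReal (ha.continuous_fst d) (ha.norm_fst_le d) t).comp hto)
  · refine eq_of_fst_eq fun d => ?_
    have hz := self_mem_strip z
    rw [(hf z hz).2.1 d]
    refine tendsto_nhds_unique (hF₃ d z hz) ?_
    have := (tendsto_smear_zero (hb.continuous_fst d) (hb.norm_fst_le d)).comp hto
    rw [h.orbit_zero] at this
    refine this.congr fun n => ?_
    rw [Function.comp, ← hb.msmear_fst (hpos n), ← hab _ (hpos n), ha.msmear_fst (hpos n)]

end SemiRep

/-! ### Norm analytic continuations -/

section NormCont

variable {E : Type*} [NormedAddCommGroup E] [NormedSpace ℂ E] [CompleteSpace E]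
  {α β γ : ℝ → E →L[ℂ] E}

/-- The function defining a norm continuation, with its properties. -/
theorem IsRep.exists_witness (h : IsRep γ) {z : ℂ} {a b : E} (hab : (a, b) ∈ contGraph γ z) :
    ∃ (f : ℂ → E) (M : ℝ), (∀ u ∈ strip z, ‖f u‖ ≤ M) ∧ ContinuousOn f (strip z) ∧
      DifferentiableOn ℂ f (interior (strip z)) ∧ (∀ t : ℝ, f t = γ t a) ∧ f z = b ∧
      ∀ t : ℝ, f (z + t) = γ t b := by
  obtain ⟨f, hc, hf', h0, hz⟩ := hab
  have hd := hf'.differentiableOn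
  have hadd : ∀ u ∈ strip z, ∀ t : ℝ, f (u + t) = γ t (f u) := fun u hu t =>
    continuousOn_analytic_unique (z := z) (f := fun u => f (u + t)) (g := fun u => γ t (f u))
      (comp_add_ofReal hc hd t).1 (comp_add_ofReal hc hd t).2
      ((γ t).continuous.comp_continuousOn hc) ((γ t).differentiable.comp_differentiableOn hd)
      (fun s => by rw [← Complex.ofReal_add, h0, h0, add_comm, h.add_apply]) hu
  have hmem : ∀ y ∈ uIcc 0 z.im, (y * Complex.I : ℂ) ∈ strip z := fun y hy => by
    simpa [strip] using hy
  obtain ⟨M, hM⟩ := isCompact_uIcc.exists_bound_of_continuousOn (s := uIcc 0 z.im)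
    (f := fun y : ℝ => f (y * Complex.I)) (hc.comp (by fun_prop) hmem)
  refine ⟨f, M, fun u hu => ?_, hc, hd, h0, hz, fun t => ?_⟩
  · have e : u = u.im * Complex.I + u.re := by
      rw [add_comm]; exact (Complex.re_add_im u).symm
    rw [e, hadd _ (hmem _ hu)]
    exact (h.norm_apply_le _ _).trans (hM _ hu)
  · rw [hadd z (self_mem_strip z), show f z = b from hz]

theorem IsRep.smear_eq_of_mem (h : IsRep γ) {z : ℂ} {a b : E} (hab : (a, b) ∈ contGraph γ z)
    {r : ℝ} (hr : 0 < r) : smear r (fun t => γ t a) z = smear r (fun t => γ t b) 0 := by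
  obtain ⟨f, M, hM, hc, hd, h0, -, hadd⟩ := h.exists_witness hab
  simpa only [h0, hadd] using smear_eq_integral_shift hr hc hd hM

theorem IsRep.smear_mem (h : IsRep γ) (w z : ℂ) (a : E) {r : ℝ} (hr : 0 < r) :
    (smear r (fun t => γ t a) w, smear r (fun t => γ t a) (w + z)) ∈ contGraph γ z := by
  have hd := differentiable_smear hr (h.continuous a) (fun t => h.norm_apply_le t a)
  have hd' : Differentiable ℂ fun u => smear r (fun t => γ t a) (w + u) :=
    hd.comp (by fun_prop)
  exact ⟨fun u => smear r (fun t => γ t a) (w + u), hd'.continuous.continuousOn,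
    hd'.differentiableOn.analyticOnNhd isOpen_interior, fun t => h.smear_add hr a w t, rfl⟩

/-- Gaussian smearing along a representation, as a bounded operator. -/
def IsRep.smearCLM (h : IsRep γ) {r : ℝ} (hr : 0 < r) (u : ℂ) : E →L[ℂ] E :=
  LinearMap.mkContinuous
    { toFun := fun x => smear r (fun t => γ t x) u
      map_add' := fun x y => by
        simp only [smear, map_add, smul_add]
        exact integral_add
          (integrable_gauss_smul hr (h.continuous x) (fun t => h.norm_apply_le t x) u)
          (integrable_gauss_smul hr (h.continuous y) (fun t => h.norm_apply_le t y) u)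
      map_smul' := fun c x => by
        simp only [smear, map_smul, RingHom.id_apply]
        rw [← integral_smul]
        simp_rw [smul_comm c] }
    (Real.exp (r * u.im ^ 2)) fun x => norm_smear_le hr (fun t => h.norm_apply_le t x) u

theorem IsRep.map_smear_comm (h : IsRep γ) {r : ℝ} (hr : 0 < r) (u : ℂ) {T : E →L[ℂ] E}
    (hT : ∀ t x, T (γ t x) = γ t (T x)) (x : E) :
    T (smear r (fun t => γ t x) u) = smear r (fun t => γ t (T x)) u := by
  rw [map_smear T hr (h.continuous x) (fun t => h.norm_apply_le t x)]
  simp_rw [hT]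

/-- Smearing `D(γ_z)` along `β` produces elements on which `γ_z` is the product of `α_z` and `β_z`,
in either order. -/
theorem smear_mem_pcomp_graph (hβ : IsRep β) (hγ : IsRep γ)
    (hcomm : ∀ s t x, α s (β t x) = β t (α s x)) (hγαβ : ∀ t x, γ t x = α t (β t x)) {z : ℂ}
    {x y : E} (hxy : (x, y) ∈ contGraph γ z) {r : ℝ} (hr : 0 < r) :
    (smear r (fun t => β t x) 0, smear r (fun t => β t y) 0) ∈
        (pcomp (cont α z) (cont β z)).graph ∧
      (smear r (fun t => β t x) 0, smear r (fun t => β t y) 0) ∈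
        (pcomp (cont β z) (cont α z)).graph := by
  obtain ⟨f, M, hM, hc, hd, h0, hz, -⟩ := hγ.exists_witness hxy
  have hγβ : ∀ s t v, γ s (β t v) = β t (γ s v) := fun s t v => by
    rw [hγαβ, hγαβ, ← hβ.add_apply, add_comm, hβ.add_apply, hcomm]
  have key : ∀ w : ℂ, (smear r (fun t => β t x) w, smear r (fun t => β t y) (w - z)) ∈
      contGraph α z := by
    intro w
    have hΦ : ∀ u ∈ strip z, ∀ t, ‖β t (f u)‖ ≤ M := fun u hu t =>
      (hβ.norm_apply_le _ _).trans (hM u hu)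
    refine ⟨fun u => smear r (fun t => β t (f u)) (w - u), ?_, ?_, fun t => ?_, ?_⟩
    · exact continuousOn_integral_gauss hr (continuous_const.sub continuous_id)
        (fun u _ => hβ.continuous (f u)) hΦ fun t => (β t).continuous.comp_continuousOn hc
    · refine DifferentiableOn.analyticOnNhd ?_ isOpen_interior
      exact differentiableOn_integral_gauss hr ((differentiable_const w).sub differentiable_id)
        isOpen_interior (fun u _ => hβ.continuous (f u)) (fun u hu => hΦ u (interior_subset hu))
        fun t => (β t).differentiable.comp_differentiableOn hd
    · have e : w - (t : ℂ) = w + ((-t : ℝ) : ℂ) := by push_cast; ring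
      simp only [h0]
      rw [e, hβ.smear_add hr, ← hβ.map_smear_comm hr w (T := γ t) (fun s v => hγβ t s v), hγαβ,
        hcomm, hβ.neg_apply]
    · simp only [hz]
  constructor
  · refine mem_pcomp_graph.2 ⟨smear r (fun t => β t x) z, ?_, ?_⟩
    · rw [cont_graph]
      simpa using hβ.smear_mem 0 z x hr
    · rw [cont_graph]
      simpa using key z
  · refine mem_pcomp_graph.2 ⟨smear r (fun t => β t y) (-z), ?_, ?_⟩
    · rw [cont_graph]
      simpa using key 0
    · rw [cont_graph]
      simpa using hβ.smear_mem (-z) z y hr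

end NormCont

/-! ### Comparison of norm and strict continuations -/

section Compare

variable {A : Type*} [NonUnitalCStarAlgebra A] {γ γl γr : ℝ → A →L[ℂ] A}

theorem norm_coe_le (a : A) : ‖(a : 𝓜(ℂ, A))‖ ≤ ‖a‖ :=
  norm_le_of_fst_apply_le (norm_nonneg _) fun d => norm_mul_le a d

theorem SemiRep.incl_mem (h : SemiRep γ γl γr) {z : ℂ} {x y : A} (hxy : (x, y) ∈ contGraph γ z) :
    (incl A x, incl A y) ∈ strictContGraph γ z := by
  obtain ⟨f, M, hM, hc, hd, h0, hz, -⟩ := h.rep.exists_witness hxy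
  refine mem_strictContGraph_of_fst (f := fun u => incl A (f u)) (M := M)
    (fun u hu => (norm_coe_le _).trans (hM u hu)) (fun d => ?_) (fun d => ?_) (fun d => ?_)
    (fun t => ?_) (by rw [hz])
  · exact hc.mul continuousOn_const
  · exact continuousOn_const.mul hc
  · exact ((ContinuousLinearMap.mul ℂ A).flip d).differentiable.comp_differentiableOn hd
  · rw [h0]
    exact ((strictExtension_spec h.isSemiMultiplicative t).1.extends_apply x).symm

theorem continuousOn_fst_apply {f : ℂ → 𝓜(ℂ, A)} {c : ℂ → A} {S : Set ℂ} {M : ℝ}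
    (hM : ∀ u ∈ S, ‖f u‖ ≤ M) (hf : ∀ d, ContinuousOn (fun u => (f u).fst d) S)
    (hc : ContinuousOn c S) : ContinuousOn (fun u => (f u).fst (c u)) S := by
  intro u₀ hu₀
  have h1 : Tendsto (fun u => M * ‖c u - c u₀‖ + ‖(f u).fst (c u₀) - (f u₀).fst (c u₀)‖)
      (𝓝[S] u₀) (𝓝 (M * 0 + 0)) :=
    ((tendsto_iff_norm_sub_tendsto_zero.1 (hc u₀ hu₀)).const_mul M).add
      (tendsto_iff_norm_sub_tendsto_zero.1 (hf (c u₀) u₀ hu₀))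
  rw [mul_zero, add_zero] at h1
  rw [ContinuousWithinAt, tendsto_iff_norm_sub_tendsto_zero]
  refine squeeze_zero' (Eventually.of_forall fun _ => norm_nonneg _) ?_ h1
  filter_upwards [self_mem_nhdsWithin] with u hu
  calc _ = ‖(f u).fst (c u - c u₀) + ((f u).fst (c u₀) - (f u₀).fst (c u₀))‖ := by
        rw [map_sub]; congr 1; abel
    _ ≤ _ := (norm_add_le _ _).trans (by
        gcongr
        exact (norm_fst_apply_le _ _).trans (by gcongr; exact hM u hu))

theorem SemiRep.fst_smear_mem (h : SemiRep γ γl γr) {z : ℂ} {a b : 𝓜(ℂ, A)}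
    (hab : (a, b) ∈ strictContGraph γ z) {r : ℝ} (hr : 0 < r) (d : A) (w : ℂ) :
    (a.fst (smear r (fun t => γr t d) w), b.fst (smear r (fun t => γr t d) (w + z))) ∈
      contGraph γ z := by
  obtain ⟨f, M, hM, hc, -, hd, h0, hz, -⟩ := h.exists_witness hab
  have hs : Differentiable ℂ fun u => smear r (fun t => γr t d) (w + u) :=
    (differentiable_smear hr (h.right.continuous d) (fun t => h.right.norm_apply_le t d)).comp
      (by fun_prop)
  refine ⟨fun u => (f u).fst (smear r (fun t => γr t d) (w + u)), ?_, ?_, fun t => ?_, ?_⟩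
  · exact continuousOn_fst_apply hM hc hs.continuous.continuousOn
  · refine DifferentiableOn.analyticOnNhd ?_ isOpen_interior
    exact ((fstCLM A).differentiable.comp_differentiableOn hd).clm_apply hs.differentiableOn
  · simp only [h0]
    rw [h.right.smear_add hr, h.orbit_fst, h.right.neg_apply]
  · simp only [hz]

/-! ### The strict topology -/

/-- The map to a product of copies of `A` inducing the strict topology on pairs. -/
def strictEval (p : 𝓜(ℂ, A) × 𝓜(ℂ, A)) : ((A → A) × (A → A)) × ((A → A) × (A → A)) :=
  ((fun b => p.1.fst b, fun b => p.1.snd b), (fun b => p.2.fst b, fun b => p.2.snd b))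

theorem mem_strict_closure_iff {G : Set (𝓜(ℂ, A) × 𝓜(ℂ, A))} {p : 𝓜(ℂ, A) × 𝓜(ℂ, A)} :
    p ∈ @closure (𝓜(ℂ, A) × 𝓜(ℂ, A))
      (@instTopologicalSpaceProd _ _ (strictTopology A) (strictTopology A)) G ↔
      strictEval p ∈ closure (strictEval '' G) := by
  have : @instTopologicalSpaceProd 𝓜(ℂ, A) 𝓜(ℂ, A) (strictTopology A) (strictTopology A) =
      TopologicalSpace.induced strictEval inferInstance := by
    rw [strictTopology, prod_induced_induced]
    rfl
  rw [this]
  exact closure_induced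

theorem tendsto_strictEval {ι : Type*} {l : Filter ι} {v w : ι → 𝓜(ℂ, A)} {a b : 𝓜(ℂ, A)}
    (h₁ : ∀ d, Tendsto (fun i => (v i).fst d) l (𝓝 (a.fst d)))
    (h₂ : ∀ d, Tendsto (fun i => (v i).snd d) l (𝓝 (a.snd d)))
    (h₃ : ∀ d, Tendsto (fun i => (w i).fst d) l (𝓝 (b.fst d)))
    (h₄ : ∀ d, Tendsto (fun i => (w i).snd d) l (𝓝 (b.snd d))) :
    Tendsto (fun i => strictEval (v i, w i)) l (𝓝 (strictEval (a, b))) :=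
  ((tendsto_pi_nhds.2 h₁).prodMk_nhds (tendsto_pi_nhds.2 h₂)).prodMk_nhds
    ((tendsto_pi_nhds.2 h₃).prodMk_nhds (tendsto_pi_nhds.2 h₄))

/-- The graph of a strict continuation is strictly closed. -/
theorem SemiRep.mem_of_strictEval_mem_closure (h : SemiRep γ γl γr) {z : ℂ}
    {p : 𝓜(ℂ, A) × 𝓜(ℂ, A)}
    (hp : strictEval p ∈ closure (strictEval '' (strictContGraph γ z : Set _))) :
    p ∈ strictContGraph γ z := by
  obtain ⟨a, b⟩ := p
  have hgraph : ∀ {a b : 𝓜(ℂ, A)}, (a, b) ∈ strictContGraph γ z → ∀ {k m : ℝ} (hk : 0 < k),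
      0 < m → ∀ (d : A) (t : ℝ),
      h.rep.smearCLM hk z (a.fst (smear m (fun s => γr s d) (-z + (-t : ℝ)))) =
        h.rep.smearCLM hk 0 (b.fst (smear m (fun s => γr s d) (-t : ℝ))) := by
    intro a b hab k m hk hm d t
    have := h.rep.smear_eq_of_mem (h.fst_smear_mem hab hm d (-z + (-t : ℝ))) hk
    rwa [show -z + ((-t : ℝ) : ℂ) + z = ((-t : ℝ) : ℂ) by ring] at this
  have hclosed : ∀ {k m : ℝ} (hk : 0 < k), 0 < m → ∀ (d : A) (t : ℝ),
      h.rep.smearCLM hk z (a.fst (smear m (fun s => γr s d) (-z + (-t : ℝ)))) =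
        h.rep.smearCLM hk 0 (b.fst (smear m (fun s => γr s d) (-t : ℝ))) := by
    intro k m hk hm d t
    have hcl : IsClosed {q : ((A → A) × (A → A)) × ((A → A) × (A → A)) |
        h.rep.smearCLM hk z (q.1.1 (smear m (fun s => γr s d) (-z + (-t : ℝ)))) =
          h.rep.smearCLM hk 0 (q.2.1 (smear m (fun s => γr s d) (-t : ℝ)))} :=
      isClosed_eq
        ((h.rep.smearCLM hk z).continuous.comp
          ((continuous_apply _).comp (continuous_fst.comp continuous_fst)))
        ((h.rep.smearCLM hk 0).continuous.comp
          ((continuous_apply _).comp (continuous_fst.comp continuous_snd)))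
    refine closure_minimal ?_ hcl hp
    rintro _ ⟨⟨a', b'⟩, hab', rfl⟩
    exact hgraph hab' hk hm d t
  have hto : ∀ x : A, Tendsto (fun k : ℝ => smear k (fun t => γ t x) 0) atTop (𝓝 x) := fun x => by
    simpa [h.rep.zero_apply] using
      tendsto_smear_zero (h.rep.continuous x) (fun t => h.rep.norm_apply_le t x)
  have hto' : ∀ x : A, Tendsto (fun k : ℝ => smear k (fun t => γr t x) 0) atTop (𝓝 x) :=
    fun x => by
      simpa [h.right.zero_apply] using
        tendsto_smear_zero (h.right.continuous x) (fun t => h.right.norm_apply_le t x)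
  have ha := h.isStrictBounded_orbit a
  have hb := h.isStrictBounded_orbit b
  refine h.mem_of_msmear_eq fun r hr => eq_of_fst_eq fun d => ?_
  have step : ∀ {k m : ℝ} (_ : 0 < k), 0 < m →
      smear k (fun t => γ t ((msmear r (orbit γ a) z).fst (smear m (fun s => γr s d) 0))) 0 =
        smear k (fun t => γ t ((msmear r (orbit γ b) 0).fst (smear m (fun s => γr s d) 0))) 0 := by
    intro k m hk hm
    have e1 := hgraph (h.msmear_mem z a hr) hk hm d 0
    simp only [neg_zero, Complex.ofReal_zero, add_zero] at e1
    refine e1.symm.trans ?_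
    change _ = h.rep.smearCLM hk 0 _
    rw [ha.msmear_fst hr, hb.msmear_fst hr,
      map_smear _ hr (ha.continuous_fst _) (ha.norm_fst_le _),
      map_smear _ hr (hb.continuous_fst _) (hb.norm_fst_le _)]
    congr 1 with t
    have hcommu : ∀ (u : ℂ) (v : A), h.rep.smearCLM hk u (γ t v) = γ t (h.rep.smearCLM hk u v) :=
      fun u v => (h.rep.map_smear_comm hk u (T := γ t) (fun s x => by
        rw [← h.rep.add_apply, ← h.rep.add_apply, add_comm]) v).symm
    have e2 := hclosed hk hm d t
    rw [h.right.smear_add hm, show ((-t : ℝ) : ℂ) = 0 + ((-t : ℝ) : ℂ) by ring,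
      h.right.smear_add hm] at e2
    rw [h.orbit_fst, h.orbit_fst, hcommu, hcommu, e2]
  have step' : ∀ {m : ℝ}, 0 < m →
      (msmear r (orbit γ a) z).fst (smear m (fun s => γr s d) 0) =
        (msmear r (orbit γ b) 0).fst (smear m (fun s => γr s d) 0) := fun hm =>
    tendsto_nhds_unique_of_eventuallyEq (hto _) (hto _)
      ((eventually_gt_atTop 0).mono fun k hk => step hk hm)
  exact tendsto_nhds_unique_of_eventuallyEq
    (((msmear r (orbit γ a) z).fst.continuous.tendsto d).comp (hto' d))
    (((msmear r (orbit γ b) 0).fst.continuous.tendsto d).comp (hto' d))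
    ((eventually_gt_atTop 0).mono fun m hm => step' hm)

end Compare

/-! ### Products of commuting representations -/

section Product

theorem IsRep.comp {E : Type*} [NormedAddCommGroup E] [NormedSpace ℂ E] {α β : ℝ → E →L[ℂ] E}
    (hα : IsRep α) (hβ : IsRep β) (hcomm : ∀ s t x, α s (β t x) = β t (α s x)) :
    IsRep fun t => α t ∘L β t where
  add s t := by
    ext x
    simp only [ContinuousLinearMap.comp_apply]
    rw [hα.add_apply, hβ.add_apply, ← hcomm t s]
  zero := by
    ext x
    simp [hα.zero_apply, hβ.zero_apply]
  norm_le t := (ContinuousLinearMap.opNorm_comp_le _ _).trans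
    (mul_le_one₀ (hα.norm_le t) (norm_nonneg _) (hβ.norm_le t))
  continuous a := hα.continuous_comp (hβ.continuous a)

variable {A : Type*} [NonUnitalCStarAlgebra A] {α αl αr β βl βr : ℝ → A →L[ℂ] A}

theorem SemiRep.right_comm (hα : SemiRep α αl αr) (hβ : SemiRep β βl βr)
    (hcomm : ∀ s t x, α s (β t x) = β t (α s x)) (s t : ℝ) (x : A) :
    αr s (βr t x) = βr t (αr s x) := by
  refine eq_of_forall_mul_left fun c => ?_
  obtain ⟨c, rfl⟩ : ∃ c', α s (β t c') = c :=
    ⟨β (-t) (α (-s) c), by rw [hβ.rep.apply_neg, hα.rep.apply_neg]⟩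
  rw [hα.mul_right, hβ.mul_right, hcomm, hcomm, hβ.mul_right, hα.mul_right]

theorem SemiRep.left_comm (hα : SemiRep α αl αr) (hβ : SemiRep β βl βr)
    (hcomm : ∀ s t x, α s (β t x) = β t (α s x)) (s t : ℝ) (x : A) :
    αl s (βl t x) = βl t (αl s x) := by
  refine eq_of_forall_mul_right fun c => ?_
  obtain ⟨c, rfl⟩ : ∃ c', α s (β t c') = c :=
    ⟨β (-t) (α (-s) c), by rw [hβ.rep.apply_neg, hα.rep.apply_neg]⟩
  rw [hα.mul_left, hβ.mul_left, hcomm, hcomm, hβ.mul_left, hα.mul_left]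

theorem SemiRep.comp (hα : SemiRep α αl αr) (hβ : SemiRep β βl βr)
    (hcomm : ∀ s t x, α s (β t x) = β t (α s x)) :
    SemiRep (fun t => α t ∘L β t) (fun t => αl t ∘L βl t) (fun t => αr t ∘L βr t) where
  rep := hα.rep.comp hβ.rep hcomm
  left := hα.left.comp hβ.left (hα.left_comm hβ hcomm)
  right := hα.right.comp hβ.right (hα.right_comm hβ hcomm)
  mul_left t a b := by
    simp only [ContinuousLinearMap.comp_apply]
    rw [hα.mul_left, hβ.mul_left]
  mul_right t a b := by
    simp only [ContinuousLinearMap.comp_apply]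
    rw [hα.mul_right, hβ.mul_right]

theorem SemiRep.orbit_comp (hα : SemiRep α αl αr) (hβ : SemiRep β βl βr)
    (hcomm : ∀ s t x, α s (β t x) = β t (α s x)) (x : 𝓜(ℂ, A)) (t : ℝ) :
    orbit (fun t => α t ∘L β t) x t = orbit α (orbit β x t) t :=
  eq_of_fst_eq fun d => by
    rw [(hα.comp hβ hcomm).orbit_fst, hα.orbit_fst, hβ.orbit_fst]
    simp only [ContinuousLinearMap.comp_apply]
    rw [hα.right_comm hβ hcomm]

theorem SemiRep.msmear_orbit_comm (hα : SemiRep α αl αr) (hβ : SemiRep β βl βr)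
    (hcomm : ∀ s t x, α s (β t x) = β t (α s x)) {r : ℝ} (hr : 0 < r) (x : 𝓜(ℂ, A)) (t : ℝ)
    (u : ℂ) : msmear r (orbit α (orbit β x t)) u = orbit β (msmear r (orbit α x) u) t :=
  eq_of_fst_eq fun d => by
    have hx := hα.isStrictBounded_orbit x
    rw [(hα.isStrictBounded_orbit _).msmear_fst hr, hβ.orbit_fst, hx.msmear_fst hr,
      map_smear (β t) hr (hx.continuous_fst _) (hx.norm_fst_le _)]
    congr 1 with s
    rw [hα.orbit_fst, hβ.orbit_fst, hα.orbit_fst, hcomm, hα.right_comm hβ hcomm]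

theorem SemiRep.msmear_comp_mem (hα : SemiRep α αl αr) (hβ : SemiRep β βl βr)
    (hcomm : ∀ s t x, α s (β t x) = β t (α s x)) {z : ℂ} {a w y : 𝓜(ℂ, A)}
    (haw : (a, w) ∈ strictContGraph β z) (hwy : (w, y) ∈ strictContGraph α z) {r : ℝ}
    (hr : 0 < r) :
    (msmear r (orbit α a) 0, msmear r (orbit α y) 0) ∈
      strictContGraph (fun t => α t ∘L β t) z := by
  obtain ⟨f, M, hM, hc₁, hc₂, hd, h0, hz, -⟩ := hβ.exists_witness haw
  have hd' : ∀ d, DifferentiableOn ℂ (fun u => (f u).fst d) (interior (strip z)) := fun d =>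
    ((fstCLM A).flip d).differentiable.comp_differentiableOn hd
  have hb := fun u => hα.isStrictBounded_orbit (f u)
  have e₁ : ∀ d, (fun u => (msmear r (orbit α (f u)) u).fst d) =
      fun u => ∫ t : ℝ, gauss r (t - u) • α t ((f u).fst (αr (-t) d)) := fun d =>
    funext fun u => by
      rw [(hb u).msmear_fst hr, smear]
      simp_rw [hα.orbit_fst]
  have e₂ : ∀ d, (fun u => (msmear r (orbit α (f u)) u).snd d) =
      fun u => ∫ t : ℝ, gauss r (t - u) • α t ((f u).snd (αl (-t) d)) := fun d =>
    funext fun u => by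
      rw [(hb u).msmear_snd hr, smear]
      simp_rw [orbit, hα.ext_snd]
  have hcont₁ : ∀ u d, Continuous fun t => α t ((f u).fst (αr (-t) d)) := fun u d => by
    simpa only [hα.orbit_fst] using (hb u).continuous_fst d
  have hcont₂ : ∀ u d, Continuous fun t => α t ((f u).snd (αl (-t) d)) := fun u d => by
    simpa only [orbit, hα.ext_snd] using (hb u).continuous_snd d
  have hbd₁ : ∀ u ∈ strip z, ∀ d t, ‖α t ((f u).fst (αr (-t) d))‖ ≤ M * ‖d‖ := fun u hu d t => by
    rw [← hα.orbit_fst]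
    exact ((hb u).norm_fst_le d t).trans (by gcongr; exact hM u hu)
  have hbd₂ : ∀ u ∈ strip z, ∀ d t, ‖α t ((f u).snd (αl (-t) d))‖ ≤ M * ‖d‖ := fun u hu d t => by
    rw [← hα.ext_snd]
    exact ((hb u).norm_snd_le d t).trans (by gcongr; exact hM u hu)
  refine mem_strictContGraph_of_fst (f := fun u => msmear r (orbit α (f u)) u)
    (M := Real.exp (r * z.im ^ 2) * M) (fun u hu => ?_) (fun d => ?_) (fun d => ?_) (fun d => ?_)
    (fun t => ?_) ?_
  · refine ((hb u).norm_msmear_le hr u).trans ?_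
    exact mul_le_mul (Real.exp_le_exp.2 (mul_le_mul_of_nonneg_left (im_sq_le_of_mem_strip hu)
      hr.le)) (hM u hu) (norm_nonneg _) (Real.exp_pos _).le
  · rw [e₁]
    exact continuousOn_integral_gauss hr continuous_id (fun u _ => hcont₁ u d)
      (fun u hu => hbd₁ u hu d) fun t => (α t).continuous.comp_continuousOn (hc₁ _)
  · rw [e₂]
    exact continuousOn_integral_gauss hr continuous_id (fun u _ => hcont₂ u d)
      (fun u hu => hbd₂ u hu d) fun t => (α t).continuous.comp_continuousOn (hc₂ _)
  · rw [e₁]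
    exact differentiableOn_integral_gauss hr differentiable_id isOpen_interior
      (fun u _ => hcont₁ u d) (fun u hu => hbd₁ u (interior_subset hu) d)
      fun t => (α t).differentiable.comp_differentiableOn (hd' _)
  · have e := hα.msmear_add hr (orbit β a t) 0 t
    rw [zero_add] at e
    rw [h0, e, hα.msmear_orbit_comm hβ hcomm hr, hα.orbit_comp hβ hcomm]
  · simp only [hz]
    exact hα.msmear_eq_of_mem hwy hr

theorem SemiRep.tendsto_msmear_zero (h : SemiRep α αl αr) (x : 𝓜(ℂ, A)) (d : A) :
    Tendsto (fun r : ℝ => (msmear r (orbit α x) 0).fst d) atTop (𝓝 (x.fst d)) ∧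
      Tendsto (fun r : ℝ => (msmear r (orbit α x) 0).snd d) atTop (𝓝 (x.snd d)) := by
  have hx := h.isStrictBounded_orbit x
  have h₁ := tendsto_smear_zero (hx.continuous_fst d) (hx.norm_fst_le d)
  have h₂ := tendsto_smear_zero (hx.continuous_snd d) (hx.norm_snd_le d)
  rw [h.orbit_zero] at h₁ h₂
  exact ⟨h₁.congr' ((eventually_gt_atTop 0).mono fun r hr => (hx.msmear_fst hr 0 d).symm),
    h₂.congr' ((eventually_gt_atTop 0).mono fun r hr => (hx.msmear_snd hr 0 d).symm)⟩

/-- The product of the strict continuations is contained in the strict continuation of the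
product. -/
theorem SemiRep.comp_mem (hα : SemiRep α αl αr) (hβ : SemiRep β βl βr)
    (hcomm : ∀ s t x, α s (β t x) = β t (α s x)) {z : ℂ} {a w y : 𝓜(ℂ, A)}
    (haw : (a, w) ∈ strictContGraph β z) (hwy : (w, y) ∈ strictContGraph α z) :
    (a, y) ∈ strictContGraph (fun t => α t ∘L β t) z := by
  refine (hα.comp hβ hcomm).mem_of_strictEval_mem_closure ?_
  refine mem_closure_of_tendsto (tendsto_strictEval
    (fun d => (hα.tendsto_msmear_zero a d).1) (fun d => (hα.tendsto_msmear_zero a d).2)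
    (fun d => (hα.tendsto_msmear_zero y d).1) (fun d => (hα.tendsto_msmear_zero y d).2)) ?_
  filter_upwards [eventually_gt_atTop 0] with r hr
  exact ⟨_, hα.msmear_comp_mem hβ hcomm haw hwy hr, rfl⟩

theorem SemiRep.pcomp_le (hα : SemiRep α αl αr) (hβ : SemiRep β βl βr)
    (hcomm : ∀ s t x, α s (β t x) = β t (α s x)) (z : ℂ) :
    pcomp (strictCont α z) (strictCont β z) ≤ strictCont (fun t => α t ∘L β t) z := by
  refine LinearPMap.le_of_le_graph ?_
  rintro ⟨a, y⟩ hay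
  obtain ⟨w, haw, hwy⟩ := mem_pcomp_graph.1 hay
  rw [strictCont_graph] at haw hwy ⊢
  exact hα.comp_mem hβ hcomm haw hwy

end Product

/-! ### Approximate units -/

section ApproximateUnit

variable {A : Type*} [NonUnitalCStarAlgebra A]

theorem exists_approximateUnit (A : Type*) [NonUnitalCStarAlgebra A] :
    ∃ l : Filter A, l.NeBot ∧ (∀ x, Tendsto (fun e => e * x) l (𝓝 x)) ∧
      (∀ x, Tendsto (fun e => x * e) l (𝓝 x)) ∧ ∀ᶠ e in l, ‖e‖ ≤ 1 := by
  let _ := CStarAlgebra.spectralOrder A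
  let _ := CStarAlgebra.spectralOrderedRing A
  have hE := CStarAlgebra.increasingApproximateUnit A
  exact ⟨CStarAlgebra.approximateUnit A, hE.neBot, fun x => hE.tendsto_mul_right x,
    fun x => hE.tendsto_mul_left x, hE.eventually_norm⟩

/-- Dominated convergence along a bounded approximate unit, which need not be countable. -/
theorem tendsto_integral_approximateUnit {E : Type*} [NormedAddCommGroup E] [NormedSpace ℂ E]
    {l : Filter E} {B : E →L[ℂ] E →L[ℂ] E} (hB : ∀ x, Tendsto (fun e => B e x) l (𝓝 x))
    (hB' : ∀ᶠ e in l, ‖B e‖ ≤ 1) {F : ℝ → E} (hF : Continuous F) {M : ℝ} (hM : ∀ t, ‖F t‖ ≤ M)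
    {k : ℝ → ℝ} (hk : Integrable k) (hk' : Continuous k) :
    Tendsto (fun e => ∫ t, k t * ‖B e (F t) - F t‖) l (𝓝 0) := by
  have hM0 : 0 ≤ M := (norm_nonneg _).trans (hM 0)
  set L : Filter E := (⨅ q : ℚ, comap (fun e => B e (F q)) (𝓝 (F q))) ⊓ 𝓟 {e | ‖B e‖ ≤ 1}
  have hl : l ≤ L := le_inf (le_iInf fun q => tendsto_iff_comap.1 (hB (F q)))
    (le_principal_iff.2 hB')
  refine Tendsto.mono_left ?_ hl
  have hL1 : ∀ᶠ e in L, ‖B e‖ ≤ 1 := mem_inf_of_right (mem_principal_self _)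
  have hLq : ∀ q : ℚ, Tendsto (fun e => B e (F q)) L (𝓝 (F q)) := fun q =>
    tendsto_iff_comap.2 (inf_le_left.trans (iInf_le _ q))
  have hLt : ∀ t : ℝ, Tendsto (fun e => B e (F t)) L (𝓝 (F t)) := by
    intro t
    rw [Metric.tendsto_nhds]
    intro ε hε
    obtain ⟨q, hq⟩ := Rat.denseRange_cast.exists_mem_open
      (isOpen_ball.preimage hF) ⟨t, mem_ball_self (x := F t) (show 0 < ε / 3 by positivity)⟩
    have hq' : ‖F q - F t‖ < ε / 3 := by simpa [dist_eq_norm] using hq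
    filter_upwards [hL1, Metric.tendsto_nhds.1 (hLq q) (ε / 3) (by positivity)] with e he heq
    rw [dist_eq_norm] at heq ⊢
    have h1 : ‖B e (F t - F q)‖ ≤ ‖F t - F q‖ :=
      ((B e).le_of_opNorm_le he _).trans (by rw [one_mul])
    rw [norm_sub_rev] at hq'
    calc ‖B e (F t) - F t‖ = ‖B e (F t - F q) + (B e (F q) - F q) - (F t - F q)‖ := by
          rw [map_sub]; congr 1; abel
      _ ≤ ‖B e (F t - F q)‖ + ‖B e (F q) - F q‖ + ‖F t - F q‖ :=
          (norm_sub_le _ _).trans (by gcongr; exact norm_add_le _ _)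
      _ < ε := by linarith
  have key := tendsto_integral_filter_of_dominated_convergence (μ := volume) (l := L)
    (F := fun e t => k t * ‖B e (F t) - F t‖) (f := fun _ => (0 : ℝ))
    (fun t => ‖k t‖ * (M + M)) ?_ ?_ (hk.norm.mul_const _) ?_
  · simpa using key
  · refine Eventually.of_forall fun e => Continuous.aestronglyMeasurable ?_
    fun_prop
  · filter_upwards [hL1] with e he
    refine Eventually.of_forall fun t => ?_
    rw [norm_mul, norm_norm]
    gcongr
    refine (norm_sub_le _ _).trans (add_le_add ?_ (hM t))
    exact ((B e).le_of_opNorm_le he _).trans (by rw [one_mul]; exact hM t)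
  · refine Eventually.of_forall fun t => ?_
    simpa using (tendsto_iff_norm_sub_tendsto_zero.1 (hLt t)).const_mul (k t)

theorem IsRep.tendsto_smear_approximateUnit {E : Type*} [NormedAddCommGroup E] [NormedSpace ℂ E]
    [CompleteSpace E] {ρ : ℝ → E →L[ℂ] E} (h : IsRep ρ) {l : Filter E} {B : E →L[ℂ] E →L[ℂ] E}
    (hρ : ∀ t x y, ρ t (B x y) = B (ρ t x) (ρ t y)) (hB : ∀ x, Tendsto (fun e => B e x) l (𝓝 x))
    (hB' : ∀ᶠ e in l, ‖B e‖ ≤ 1) {r : ℝ} (hr : 0 < r) (w : ℂ) (x : E) :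
    Tendsto (fun e => B (smear r (fun t => ρ t e) w) x) l (𝓝 x) := by
  rw [tendsto_iff_norm_sub_tendsto_zero]
  have key := tendsto_integral_approximateUnit hB hB' (F := fun t => ρ (-t) x)
    ((h.continuous x).comp continuous_neg) (fun t => h.norm_apply_le _ x)
    (integrable_gauss_sub hr w).norm (continuous_gauss_sub r w).norm
  refine squeeze_zero (fun _ => norm_nonneg _) (fun e => ?_) key
  have hBc : Continuous fun t => B (ρ t e) x := (B.flip x).continuous.comp (h.continuous e)
  have hBb : ∀ t, ‖B (ρ t e) x‖ ≤ ‖B‖ * ‖e‖ * ‖x‖ := fun t =>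
    (B.le_opNorm₂ _ _).trans (by gcongr; exact h.norm_apply_le t e)
  have e1 : B (smear r (fun t => ρ t e) w) x = smear r (fun t => B (ρ t e) x) w :=
    map_smear (B.flip x) hr (h.continuous e) (fun t => h.norm_apply_le t e) w
  have e2 : B (smear r (fun t => ρ t e) w) x - x =
      ∫ t : ℝ, gauss r (t - w) • (B (ρ t e) x - x) := by
    simp_rw [smul_sub]
    rw [integral_sub (integrable_gauss_smul hr hBc hBb w)
      (integrable_gauss_smul hr continuous_const (fun _ => le_rfl) w), e1]
    congr 1
    exact (smear_const hr x w).symm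
  have e3 : ∀ t, B (ρ t e) x - x = ρ t (B e (ρ (-t) x) - ρ (-t) x) := fun t => by
    rw [map_sub, hρ, h.apply_neg]
  rw [e2]
  refine norm_integral_le_of_norm_le ?_ (Eventually.of_forall fun t => ?_)
  · refine (integrable_gauss_sub hr w).norm.mul_bdd (c := ‖B e‖ * ‖x‖ + ‖x‖)
      (Continuous.aestronglyMeasurable ?_) (Eventually.of_forall fun t => ?_)
    · have := (h.continuous x).comp continuous_neg
      exact (((B e).continuous.comp this).sub this).norm
    · rw [norm_norm]
      refine (norm_sub_le _ _).trans (add_le_add ?_ (h.norm_apply_le _ x))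
      exact ((B e).le_opNorm _).trans (by gcongr; exact h.norm_apply_le _ x)
  · rw [norm_smul, e3]
    gcongr
    exact h.norm_apply_le _ _

variable {γ γl γr : ℝ → A →L[ℂ] A}

/-- Strict continuations are approximated by norm continuations. -/
theorem SemiRep.strictEval_mem_of_isClosed (h : SemiRep γ γl γr) {z : ℂ} {a b : 𝓜(ℂ, A)}
    (hab : (a, b) ∈ strictContGraph γ z) {C : Set (((A → A) × (A → A)) × ((A → A) × (A → A)))}
    (hC : IsClosed C)
    (hxy : ∀ x y, (x, y) ∈ contGraph γ z → strictEval (incl A x, incl A y) ∈ C) :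
    strictEval (a, b) ∈ C := by
  obtain ⟨l, hl, h₁, h₂, h₃⟩ := exists_approximateUnit A
  have k₁ : ∀ w x, Tendsto (fun e => smear 1 (fun t => γr t e) w * x) l (𝓝 x) := fun w x =>
    h.right.tendsto_smear_approximateUnit (B := ContinuousLinearMap.mul ℂ A) h.right_mul h₁
      (h₃.mono fun e he => (ContinuousLinearMap.opNorm_mul_apply_le ℂ A e).trans he) one_pos w x
  have k₂ : ∀ w x, Tendsto (fun e => x * smear 1 (fun t => γr t e) w) l (𝓝 x) := fun w x =>
    h.right.tendsto_smear_approximateUnit (B := (ContinuousLinearMap.mul ℂ A).flip)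
      (fun t x y => h.right_mul t y x) h₂
      (h₃.mono fun e he => ContinuousLinearMap.opNorm_le_bound _ zero_le_one fun x => by
        rw [one_mul]
        exact (norm_mul_le x e).trans (mul_le_of_le_one_right (norm_nonneg _) he)) one_pos w x
  have q₁ : ∀ (c : 𝓜(ℂ, A)) w d,
      Tendsto (fun e => (incl A (c.fst (smear 1 (fun t => γr t e) w))).fst d) l
        (𝓝 (c.fst d)) := fun c w d => by
    refine ((c.fst.continuous.tendsto d).comp (k₁ w d)).congr fun e => ?_
    exact fst_mul c _ d
  have q₂ : ∀ (c : 𝓜(ℂ, A)) w d,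
      Tendsto (fun e => (incl A (c.fst (smear 1 (fun t => γr t e) w))).snd d) l
        (𝓝 (c.snd d)) := fun c w d => by
    refine (k₂ w (c.snd d)).congr fun e => ?_
    exact c.central d _
  refine hC.mem_of_tendsto (tendsto_strictEval (q₁ a 0) (q₂ a 0) (q₁ b (0 + z)) (q₂ b (0 + z)))
    (Eventually.of_forall fun e => hxy _ _ (h.fst_smear_mem hab one_pos e 0))

end ApproximateUnit

/-! ### The strict core -/

section Core

variable {A : Type*} [NonUnitalCStarAlgebra A] {α αl αr β βl βr : ℝ → A →L[ℂ] A}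

theorem mem_domRestrict_graph {E : Type*} [AddCommGroup E] [Module ℂ E] {T : E →ₗ.[ℂ] E}
    {S : Submodule ℂ E} {x y : E} :
    (x, y) ∈ (T.domRestrict S).graph ↔ x ∈ S ∧ (x, y) ∈ T.graph := by
  simp only [LinearPMap.mem_graph_iff]
  constructor
  · rintro ⟨⟨v, hv⟩, rfl, rfl⟩
    exact ⟨hv.1, ⟨v, hv.2⟩, rfl, rfl⟩
  · rintro ⟨hS, ⟨v, hv⟩, rfl, rfl⟩
    exact ⟨⟨v, hS, hv⟩, rfl, rfl⟩

theorem SemiRep.isStrictCore (hα : SemiRep α αl αr) (hβ : SemiRep β βl βr)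
    (hcomm : ∀ s t x, α s (β t x) = β t (α s x)) (z : ℂ) :
    IsStrictCore (strictCont (fun t => α t ∘L β t) z)
      (((pcomp (cont α z) (cont β z)).domain ⊓ (pcomp (cont β z) (cont α z)).domain).map
        (incl A)) := by
  have hγ := hα.comp hβ hcomm
  have hincl : ∀ {p q : A}, (p, q) ∈ (pcomp (cont α z) (cont β z)).graph →
      (incl A p, incl A q) ∈ strictContGraph (fun t => α t ∘L β t) z := by
    intro p q hpq
    obtain ⟨w, hpw, hwq⟩ := mem_pcomp_graph.1 hpq
    rw [cont_graph] at hpw hwq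
    exact hα.comp_mem hβ hcomm (hβ.incl_mem hpw) (hα.incl_mem hwq)
  refine ⟨?_, Set.Subset.antisymm ?_ ?_⟩
  · rintro _ ⟨p, ⟨hp, -⟩, rfl⟩
    refine LinearPMap.mem_domain_of_mem_graph
      (y := incl A ((pcomp (cont α z) (cont β z)) ⟨p, hp⟩)) ?_
    rw [strictCont_graph]
    exact hincl (LinearPMap.mem_graph _ ⟨p, hp⟩)
  · intro p hp
    rw [strictCont_graph]
    refine hγ.mem_of_strictEval_mem_closure
      (closure_mono (Set.image_mono ?_) (mem_strict_closure_iff.1 hp))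
    rintro ⟨x, y⟩ hxy
    rw [← strictCont_graph]
    exact (mem_domRestrict_graph.1 hxy).2
  · rintro ⟨a, b⟩ hab
    rw [strictCont_graph] at hab
    refine mem_strict_closure_iff.2 (hγ.strictEval_mem_of_isClosed hab isClosed_closure ?_)
    intro x y hxy
    have hto : ∀ v : A, Tendsto (fun r : ℝ => smear r (fun t => β t v) 0) atTop (𝓝 v) :=
      fun v => by
        simpa [hβ.rep.zero_apply] using
          tendsto_smear_zero (hβ.rep.continuous v) (fun t => hβ.rep.norm_apply_le t v)
    refine mem_closure_of_tendsto (tendsto_strictEval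
      (v := fun r => incl A (smear r (fun t => β t x) 0))
      (w := fun r => incl A (smear r (fun t => β t y) 0))
      (fun d => (hto x).mul_const d) (fun d => (hto x).const_mul d)
      (fun d => (hto y).mul_const d) (fun d => (hto y).const_mul d)) ?_
    filter_upwards [eventually_gt_atTop 0] with r hr
    obtain ⟨h₁, h₂⟩ := smear_mem_pcomp_graph hβ.rep hγ.rep hcomm (fun _ _ => rfl) hxy hr
    refine ⟨_, mem_domRestrict_graph.2 ⟨Submodule.mem_map_of_mem
      ⟨LinearPMap.mem_domain_of_mem_graph h₁, LinearPMap.mem_domain_of_mem_graph h₂⟩, ?_⟩, rfl⟩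
    rw [strictCont_graph]
    exact hincl h₁

end Core

end OneParam

end

theorem mainTheorem6 {A : Type*} [NonUnitalCStarAlgebra A] (α β γ : ℝ → A →L[ℂ] A)
    (hα : OneParam.IsRep α) (hβ : OneParam.IsRep β)
    (hαm : OneParam.IsSemiMultiplicative α) (hβm : OneParam.IsSemiMultiplicative β)
    (hcomm : ∀ s t : ℝ, α s ∘L β t = β t ∘L α s)
    (hγ : ∀ t : ℝ, γ t = α t ∘L β t) (z : ℂ) :
    OneParam.pcomp (OneParam.strictCont α z) (OneParam.strictCont β z)
        ≤ OneParam.strictCont γ z ∧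
      OneParam.pcomp (OneParam.strictCont β z) (OneParam.strictCont α z)
        ≤ OneParam.strictCont γ z ∧
      OneParam.IsStrictCore (OneParam.strictCont γ z)
        (((OneParam.pcomp (OneParam.cont α z) (OneParam.cont β z)).domain ⊓
          (OneParam.pcomp (OneParam.cont β z) (OneParam.cont α z)).domain).map
            (OneParam.incl A)) := by
  obtain ⟨αl, αr, hα'⟩ := OneParam.exists_semiRep hα hαm
  obtain ⟨βl, βr, hβ'⟩ := OneParam.exists_semiRep hβ hβm
  have hc : ∀ s t x, α s (β t x) = β t (α s x) := fun s t x => DFunLike.congr_fun (hcomm s t) x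
  obtain rfl : γ = fun t => α t ∘L β t := funext hγ
  refine ⟨hα'.pcomp_le hβ' hc z, ?_, hα'.isStrictCore hβ' hc z⟩
  have := hβ'.pcomp_le hα' (fun s t x => (hc t s x).symm) z
  simpa only [hcomm] using this
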